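/- All functions are real-valued Lebesgue measurable functions on $(0,1)$, identified when equal almost everywhere, and $m$ is Lebesgue measure. For such $x$ (finite a.e.) let $x^*(t)=\inf\{s\ge 0:\ m(\{|x|\ge s\})\le t\}$, $t>0$, be its decreasing rearrangement, and write $y\prec\prec x$ if $\int_0^t y^*(s)\,ds\le\int_0^t x^*(s)\,ds$ for all $t\ge 0$. For $\tau>0$ the dilation $\sigma_\tau$ is defined by $(\sigma_\tau x)(s)=x(s/\tau)$ for $s\le\min\{1,\tau\}$ and $(\sigma_\tau x)(s)=0$ for $\tau<s\le 1$. A Banach space $E$ of such functions is called fully symmetric if: (i) $x\in E$ and $|y|\le|x|$ a.e. imply $y\in E$ and $\|y\|_E\le\|x\|_E$; (ii) $x\in E$ and $y^*=x^*$ imply $y\in E$ and $\|y\|_E=\|x\|_E$; (iii) $x\in E$, $y\in L_1(0,1)$ and $y\prec\prec x$ imply $y\in E$ and $\|y\|_E\le\|x\|_E$. (Then $E\subseteq L_1(0,1)$.) For $x\in L_1(0,1)$ let $\Omega(x)=\{Tx\}$ be its orbit, where $T$ runs over all absolute contractions, i.e. all linear operators $T:L_1(0,1)\to L_1(0,1)$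 with $\max(\|T\|_{L_1\to L_1},\|T\|_{L_\infty\to L_\infty})\le 1$. Theorem. Let $E$ be a fully symmetric space on $(0,1)$. (a) If $x\in E$ and $\varphi(x):=\lim_{s\to\infty}\frac1s\|\sigma_s(x^*)\|_E=0$, then $\Omega(x)$ is the closure, in the norm of $E$, of the convex hull of its extreme points. (b) (Braverman--Mekler) In particular, if $\lim_{\tau\to\infty}\frac1\tau\|\sigma_\tau\|_{E\to E}=0$, then $\Omega(x)$ is the closure, in the norm of $E$, of the convex hull of its extreme points for every $x\in E$. -/

import Mathlib

noncomputable section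

open MeasureTheory Set Filter Topology
open scoped ENNReal

namespace SymmetricSpaces

/-- Lebesgue measure on the interval `(0,1)`. -/
abbrev leb : Measure ℝ := (volume : Measure ℝ).restrict (Ioo (0 : ℝ) 1)

/-- Real-valued measurable functions on `(0,1)`, with identification almost everywhere. -/
abbrev L0 : Type := ℝ →ₘ[leb] ℝ

/-- The space `L₁(0,1)`; on `(0,1)` one has `L₁ + L_∞ = L₁`. -/
abbrev L1 : Type := Lp ℝ 1 leb

/-! ### Rearrangement, submajorization, dilation -/

/-- The set of levels `s ≥ 0` with `m {|x| ≥ s} ≤ t`. -/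
def levels (x : L0) (t : ℝ) : Set ℝ :=
  {s : ℝ | 0 ≤ s ∧ leb {u | s ≤ |x u|} ≤ ENNReal.ofReal t}

/-- The decreasing rearrangement `x*(t) = inf {s ≥ 0 : m {|x| ≥ s} ≤ t}` as a function of `t > 0`. -/
def rearrFun (x : L0) (t : ℝ) : ℝ := sInf (levels x t)

theorem levels_nonempty (x : L0) {t : ℝ} (ht : 0 < t) : (levels x t).Nonempty := by
  have hmeas : ∀ n : ℕ, NullMeasurableSet {u | (n : ℝ) ≤ |x u|} leb := fun n =>
    (measurableSet_le measurable_const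
      (continuous_abs.measurable.comp x.stronglyMeasurable.measurable)).nullMeasurableSet
  have hanti : Antitone fun n : ℕ => {u | (n : ℝ) ≤ |x u|} := fun m n hmn u hu =>
    le_trans (by exact_mod_cast hmn) (show (n : ℝ) ≤ |x u| from hu)
  have hempty : ⋂ n : ℕ, {u | (n : ℝ) ≤ |x u|} = ∅ := by
    ext u
    simp only [mem_iInter, mem_ofPred_eq, mem_empty_iff_false, iff_false, not_forall, not_le]
    exact exists_nat_gt _
  have hlim := tendsto_measure_iInter_atTop (μ := leb) hmeas hanti ⟨0, measure_ne_top _ _⟩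
  rw [hempty, measure_empty] at hlim
  obtain ⟨n, hn⟩ := (hlim.eventually (gt_mem_nhds (ENNReal.ofReal_pos.2 ht))).exists
  exact ⟨n, Nat.cast_nonneg n, hn.le⟩

theorem rearrFun_antitoneOn (x : L0) : AntitoneOn (rearrFun x) (Ioo 0 1) := by
  intro s hs t _ hst
  exact csInf_le_csInf ⟨0, fun _ h => h.1⟩ (levels_nonempty x hs.1)
    fun r hr => ⟨hr.1, hr.2.trans (ENNReal.ofReal_le_ofReal hst)⟩

/-- The decreasing rearrangement `x*` as an element of `L₀(0,1)`. -/
def rearr (x : L0) : L0 :=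
  AEEqFun.mk (rearrFun x)
    (aemeasurable_restrict_of_antitoneOn measurableSet_Ioo
      (rearrFun_antitoneOn x)).aestronglyMeasurable

/-- Hardy-Littlewood-Polya submajorization: `y ≺≺ x` iff
`∫₀ᵗ y* ≤ ∫₀ᵗ x*` for all `t ≥ 0`. -/
def Submajorized (y x : L0) : Prop :=
  ∀ t : ℝ, 0 ≤ t →
    ∫⁻ s in Ioc 0 t, ENNReal.ofReal (rearrFun y s) ≤
      ∫⁻ s in Ioc 0 t, ENNReal.ofReal (rearrFun x s)

/-- The dilation `σ_τ` on `L₀(0,1)`, for `τ > 0`: `(σ_τ x)(s) = x(s/τ)` for `s ≤ min {1, τ}`, and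
`(σ_τ x)(s) = 0` for `τ < s ≤ 1`. -/
def dilation (τ : ℝ) (x : L0) : L0 :=
  AEEqFun.mk (fun s => if s ≤ τ then x (s / τ) else 0)
    (Measurable.ite measurableSet_Iic
      (x.stronglyMeasurable.measurable.comp (measurable_id.div_const τ))
      measurable_const).aestronglyMeasurable

/-! ### Absolute contractions and orbits -/

/-- The semigroup `Σ` of absolute contractions: linear operators on `L₁ + L_∞ = L₁` that are
contractions both in `L₁` and in `L_∞`. -/
def absoluteContractions : Set (L1 →ₗ[ℝ] L1) :=
  {T | (∀ f : L1, ‖T f‖ ≤ ‖f‖) ∧ ∀ f : L1, eLpNorm (T f) ∞ leb ≤ eLpNorm f ∞ leb}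

/-- The orbit `Ω(x) = {T x : T ∈ Σ}` of `x ∈ L₁`. -/
def orbit (x : L0) : Set L0 :=
  {y | ∃ f : L1, (f : L0) = x ∧ ∃ T ∈ absoluteContractions, ((T f : L1) : L0) = y}

/-! ### Normed function spaces -/

/-- A normed linear space of (classes of) measurable functions on `(0,1)`. -/
structure FunctionSpace where
  carrier : Submodule ℝ L0
  nrm : AddGroupNorm carrier
  nrm_smul : ∀ (c : ℝ) (f : carrier), nrm (c • f) = |c| * nrm f

namespace FunctionSpace

variable (E : FunctionSpace)

instance : NormedAddCommGroup E.carrier := E.nrm.toNormedAddCommGroup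

instance : NormedSpace ℝ E.carrier where
  norm_smul_le c f := (E.nrm_smul c f).le

open Classical in
/-- The norm of `E`, extended by the value `∞` to functions outside `E`. -/
def enorm (f : L0) : ℝ≥0∞ :=
  if h : f ∈ E.carrier then ENNReal.ofReal ‖(⟨f, h⟩ : E.carrier)‖ else ∞

/-- `E` is a Banach space and an ideal lattice: if `x ∈ E` and `|y| ≤ |x|`, then `y ∈ E` and
`‖y‖ ≤ ‖x‖`. -/
structure IsBanachIdealLattice : Prop where
  complete : CompleteSpace E.carrier
  ideal : ∀ x ∈ E.carrier, ∀ y : L0, (∀ᵐ t ∂leb, |y t| ≤ |x t|) →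
    y ∈ E.carrier ∧ E.enorm y ≤ E.enorm x

/-- Symmetric space: if `x ∈ E` and `y* = x*`, then `y ∈ E` and `‖y‖ = ‖x‖`. -/
structure IsSymmetric : Prop extends E.IsBanachIdealLattice where
  symmetric : ∀ x ∈ E.carrier, ∀ y : L0, rearr y = rearr x →
    y ∈ E.carrier ∧ E.enorm y = E.enorm x

/-- Fully symmetric space: a symmetric space such that if `x ∈ E`, `y ∈ L₁ + L_∞ = L₁` and
`y ≺≺ x`, then `y ∈ E` and `‖y‖ ≤ ‖x‖`. -/
structure IsFullySymmetric : Prop extends E.IsSymmetric where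
  fullySymmetric : ∀ x ∈ E.carrier, ∀ y ∈ Lp ℝ 1 leb, Submajorized y x →
    y ∈ E.carrier ∧ E.enorm y ≤ E.enorm x

/-- The operator norm `‖σ_τ‖_{E → E}` (equal to `∞` if `σ_τ` is not a bounded operator on `E`). -/
def dilationNorm (τ : ℝ) : ℝ≥0∞ :=
  ⨆ f : L0, ⨆ _ : E.enorm f ≤ 1, E.enorm (dilation τ f)

/-- The closed convex hull, with respect to the norm of `E`, of the members of `E` lying in `S`. -/
def closedConvexHull (S : Set L0) : Set L0 :=
  ((↑) : E.carrier → L0) '' closure (convexHull ℝ (((↑) : E.carrier → L0) ⁻¹' S))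

end FunctionSpace

end SymmetricSpaces

end

noncomputable section

open MeasureTheory Set Filter Topology
open scoped ENNReal

namespace SymmetricSpaces

/-! Functions whose modulus has the distribution of |x| turn out to be extreme points of Ω(x). The
theorem therefore reduces to approximating every y = Tx, in the norm of E, by convex combinations of
such functions. The opposite inclusion is soft: Ω(x) is convex and closed in L₁ (`isClosed_orbit`),
and E embeds continuously into L₁.

Submajorization is handled throughout by the excesses ∫(|y| - l)₊, l ≥ 0. An absolute contraction
does not increase them. If z is equimeasurable with x and z = au + bv in the orbit, then equality
must hold at every level in the convexity inequality for (|·| - l)₊, and this forces u = v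
(`mem_extremePoints_orbit`).

For the approximation, cut (0,1) into the cells where |y| lies in [kε, (k+1)ε). The adjoint of T,
applied to the signed indicators of the cells, yields a kernel which is completed to have full
marginals. It writes the law of |x| as a mixture of probability laws ν_k, weighted by the measures
of the cells, with mean of ν_k at least kε (`exists_level_laws`). On each cell choose a uniform
variable U and put X_j = quantile of ν_k at U + j/N mod 1. Rotation invariance gives each X_j the
law of |x|. For fixed t the values X_j(t) form a Riemann sum of a decreasing function, so their
average w reaches the mean of ν_k up to the integral H of the quantile over (0, 1/N)
(`exists_dominating_average`). Concavity of truncated tails gives H ≺≺ N⁻¹σ_N(x*), whose norm tends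
to 0 by hypothesis.

Thus |y| ≤ ε + H + w. Up to an error bounded by ε + H, y equals m·w with |m| ≤ 1, and a binary
expansion of m into functions with values ±1 approximates m·w by convex combinations of functions
equimeasurable with x (`exists_mem_convexHull_mul`). -/

instance : IsProbabilityMeasure leb := ⟨by simp [leb]⟩

/-! ### Quantile functions -/

/-- The decreasing quantile function of a measure on the half line. -/
def quantile (ν : Measure ℝ) (t : ℝ) : ℝ :=
  if 0 < t then sInf {s | 0 ≤ s ∧ ν (Ioi s) ≤ ENNReal.ofReal t} else 0

theorem exists_tail_le (ν : Measure ℝ) [IsFiniteMeasure ν] {t : ℝ} (ht : 0 < t) :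
    {s | 0 ≤ s ∧ ν (Ioi s) ≤ ENNReal.ofReal t}.Nonempty := by
  have hanti : Antitone fun n : ℕ => Ioi (n : ℝ) := fun m n hmn =>
    Ioi_subset_Ioi (by exact_mod_cast hmn)
  have hempty : ⋂ n : ℕ, Ioi (n : ℝ) = ∅ := by
    ext u
    simp only [mem_iInter, mem_Ioi, mem_empty_iff_false, iff_false, not_forall, not_lt]
    exact exists_nat_ge u
  have hlim := tendsto_measure_iInter_atTop (μ := ν)
    (fun n : ℕ => (measurableSet_Ioi (a := (n : ℝ))).nullMeasurableSet) hanti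
    ⟨0, measure_ne_top _ _⟩
  rw [hempty, measure_empty] at hlim
  obtain ⟨n, hn⟩ := (hlim.eventually (gt_mem_nhds (ENNReal.ofReal_pos.2 ht))).exists
  exact ⟨n, Nat.cast_nonneg n, hn.le⟩

theorem quantile_nonneg (ν : Measure ℝ) (t : ℝ) : 0 ≤ quantile ν t := by
  unfold quantile
  split_ifs with h
  · exact Real.sInf_nonneg fun s hs => hs.1
  · exact le_rfl

/-- The infimum is attained because s ↦ ν(Ioi s) is right-continuous: Ioi s is the increasing union
of the half lines starting at s + 1/(n+1). -/
theorem quantile_le_iff (ν : Measure ℝ) [IsFiniteMeasure ν] {t s : ℝ} (ht : 0 < t) (hs : 0 ≤ s) :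
    quantile ν t ≤ s ↔ ν (Ioi s) ≤ ENNReal.ofReal t := by
  rw [quantile, if_pos ht]
  constructor
  · intro h
    have hU : Ioi s = ⋃ n : ℕ, Ioi (s + 1 / ((n : ℝ) + 1)) := by
      ext u
      simp only [mem_iUnion, mem_Ioi]
      constructor
      · intro hu
        obtain ⟨n, hn⟩ := exists_nat_one_div_lt (sub_pos.2 hu)
        exact ⟨n, by linarith⟩
      · rintro ⟨n, hn⟩
        have : (0 : ℝ) < 1 / ((n : ℝ) + 1) := by positivity
        linarith
    have hmono : Monotone fun n : ℕ => Ioi (s + 1 / ((n : ℝ) + 1)) := fun m n hmn =>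
      Ioi_subset_Ioi (by have := Nat.one_div_le_one_div (α := ℝ) hmn; linarith)
    rw [hU, hmono.measure_iUnion]
    refine iSup_le fun n => ?_
    have hpos : (0 : ℝ) < 1 / ((n : ℝ) + 1) := by positivity
    obtain ⟨r, hr, hrs⟩ := exists_lt_of_csInf_lt (exists_tail_le ν ht)
      (lt_of_le_of_lt h (lt_add_of_pos_right s hpos))
    exact (measure_mono (Ioi_subset_Ioi hrs.le)).trans hr.2
  · intro h
    exact csInf_le ⟨0, fun _ hr => hr.1⟩ ⟨hs, h⟩

theorem lt_quantile_iff (ν : Measure ℝ) [IsFiniteMeasure ν] {t s : ℝ} (ht : 0 < t) (hs : 0 ≤ s) :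
    s < quantile ν t ↔ ENNReal.ofReal t < ν (Ioi s) := by
  rw [← not_le, quantile_le_iff ν ht hs, not_le]

theorem quantile_anti (ν : Measure ℝ) [IsFiniteMeasure ν] {s t : ℝ} (hs : 0 < s) (hst : s ≤ t) :
    quantile ν t ≤ quantile ν s := by
  rw [quantile_le_iff ν (hs.trans_le hst) (quantile_nonneg _ _)]
  exact ((quantile_le_iff ν hs (quantile_nonneg _ _)).1 le_rfl).trans
    (ENNReal.ofReal_le_ofReal hst)

theorem measurable_quantile (ν : Measure ℝ) [IsFiniteMeasure ν] : Measurable (quantile ν) := by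
  refine measurable_of_Ioi fun s => ?_
  rcases lt_or_ge s 0 with hs | hs
  · convert MeasurableSet.univ
    ext t
    simpa using hs.trans_le (quantile_nonneg ν t)
  · have : quantile ν ⁻¹' Ioi s = Ioi 0 ∩ {t | ENNReal.ofReal t < ν (Ioi s)} := by
      ext t
      simp only [mem_preimage, mem_Ioi, mem_inter_iff, mem_ofPred_eq]
      constructor
      · intro h
        have ht : 0 < t := by
          by_contra h0
          rw [quantile, if_neg h0] at h
          linarith
        exact ⟨ht, (lt_quantile_iff ν ht hs).1 h⟩
      · rintro ⟨ht, h⟩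
        exact (lt_quantile_iff ν ht hs).2 h
    rw [this]
    exact measurableSet_Ioi.inter (measurableSet_lt ENNReal.measurable_ofReal measurable_const)

/-- Lebesgue measure of the part of an initial interval on which the quantile exceeds a level. -/
theorem volume_quantile_gt (ν : Measure ℝ) [IsFiniteMeasure ν] {s : ℝ} (hs : 0 ≤ s) (b : ℝ) :
    volume (Ioo 0 b ∩ {t | s < quantile ν t}) = min (ENNReal.ofReal b) (ν (Ioi s)) := by
  have hset : Ioo 0 b ∩ {t | s < quantile ν t} = Ioo 0 (min b (ν (Ioi s)).toReal) := by
    ext t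
    simp only [mem_inter_iff, mem_Ioo, mem_ofPred_eq, lt_min_iff]
    constructor
    · rintro ⟨⟨h0, hb⟩, h⟩
      exact ⟨h0, hb, (ENNReal.ofReal_lt_iff_lt_toReal h0.le (measure_ne_top _ _)).1
        ((lt_quantile_iff ν h0 hs).1 h)⟩
    · rintro ⟨h0, hb, h⟩
      exact ⟨⟨h0, hb⟩, (lt_quantile_iff ν h0 hs).2
        ((ENNReal.ofReal_lt_iff_lt_toReal h0.le (measure_ne_top _ _)).2 h)⟩
  rw [hset, Real.volume_Ioo, sub_zero, ENNReal.ofReal_min, ENNReal.ofReal_toReal (measure_ne_top _ _)]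

/-- Two finite measures on the half line with the same total mass and tails are equal. -/
theorem measure_ext_of_tail {μ ν : Measure ℝ} [IsFiniteMeasure μ]
    (h : ∀ s, 0 ≤ s → μ (Ioi s) = ν (Ioi s)) (huniv : μ univ = ν univ)
    (hμ : μ (Iio 0) = 0) (hν : ν (Iio 0) = 0) : μ = ν := by
  have : IsFiniteMeasure ν := ⟨by rw [← huniv]; exact measure_lt_top _ _⟩
  refine ext_of_generate_finite _ (borel_eq_generateFrom_Ioi ℝ ▸ BorelSpace.measurable_eq)
    isPiSystem_Ioi ?_ huniv
  rintro _ ⟨s, rfl⟩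
  rcases lt_or_ge s 0 with hs | hs
  · have key : ∀ ρ : Measure ℝ, ρ (Iio 0) = 0 → ρ (Ioi s) = ρ univ := by
      intro ρ hρ
      refine measure_congr (Filter.eventuallyEq_univ.2 ?_)
      rw [mem_ae_iff]
      refine measure_mono_null (fun u hu => ?_) hρ
      simp only [compl_Ioi, mem_Iic] at hu
      exact lt_of_le_of_lt hu hs
    rw [key μ hμ, key ν hν, huniv]
  · exact h s hs

/-- By the Galois connection above, the quantile exceeds s ≥ 0 exactly on an initial interval of
length ν(Ioi s), so the tails agree. -/
theorem map_quantile (ν : Measure ℝ) [IsProbabilityMeasure ν] (h0 : ν (Iio 0) = 0) :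
    leb.map (quantile ν) = ν := by
  have hm := measurable_quantile ν
  have := Measure.isProbabilityMeasure_map (μ := leb) hm.aemeasurable
  refine measure_ext_of_tail (fun s hs => ?_) (by simp) ?_ h0
  · rw [Measure.map_apply hm measurableSet_Ioi, Measure.restrict_apply (hm measurableSet_Ioi),
      inter_comm]
    refine (volume_quantile_gt ν hs 1).trans ?_
    rw [ENNReal.ofReal_one, min_eq_right prob_le_one]
  · rw [Measure.map_apply hm measurableSet_Iio]
    convert measure_empty (μ := leb)
    ext t
    simpa using quantile_nonneg ν t

/-! ### Distributions and decreasing rearrangements -/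

theorem measurable_coe (x : L0) : Measurable x := x.stronglyMeasurable.measurable

/-- The distribution of `|x|`. -/
def law (x : L0) : Measure ℝ := leb.map fun t => |x t|

theorem measurable_abs_coe (x : L0) : Measurable fun t => |x t| :=
  continuous_abs.measurable.comp (measurable_coe x)

instance (x : L0) : IsProbabilityMeasure (law x) :=
  Measure.isProbabilityMeasure_map (measurable_abs_coe x).aemeasurable

theorem law_apply (x : L0) {s : Set ℝ} (hs : MeasurableSet s) :
    law x s = leb {t | |x t| ∈ s} :=
  Measure.map_apply (measurable_abs_coe x) hs

theorem law_Iio (x : L0) : law x (Iio 0) = 0 := by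
  rw [law_apply x measurableSet_Iio]
  convert measure_empty (μ := leb)
  ext t
  simp

theorem lintegral_law (x : L0) {φ : ℝ → ℝ≥0∞} (hφ : Measurable φ) :
    ∫⁻ s, φ s ∂(law x) = ∫⁻ t, φ |x t| ∂leb :=
  lintegral_map hφ (measurable_abs_coe x)

/-- One infimum runs over the sets {|x| ≥ s}, the other over {|x| > s}; these are interlaced when s
is moved slightly, so the infima agree. -/
theorem rearrFun_eq_quantile (x : L0) {t : ℝ} (ht : 0 < t) :
    rearrFun x t = quantile (law x) t := by
  refine le_antisymm ?_ ?_
  · refine le_of_forall_gt_imp_ge_of_dense fun s hs => ?_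
    obtain ⟨r, hr, hrs⟩ := exists_between hs
    have hr0 : 0 ≤ r := (quantile_nonneg _ _).trans hr.le
    refine csInf_le ⟨0, fun _ hr => hr.1⟩ ⟨hr0.trans hrs.le, ?_⟩
    refine le_trans ?_ ((quantile_le_iff (law x) ht hr0).1 hr.le)
    rw [law_apply x measurableSet_Ioi]
    exact measure_mono fun u hu => hrs.trans_le hu
  · refine le_csInf (levels_nonempty x ht) fun s hs => ?_
    rw [quantile_le_iff _ ht hs.1, law_apply x measurableSet_Ioi]
    exact le_trans (measure_mono fun u (hu : s < |x u|) => hu.le) hs.2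

theorem coe_rearr (x : L0) : rearr x =ᵐ[leb] quantile (law x) := by
  refine (AEEqFun.coeFn_mk _ _).trans ?_
  filter_upwards [ae_restrict_mem measurableSet_Ioo] with t ht
  exact rearrFun_eq_quantile x ht.1

theorem law_congr {x : L0} {f : ℝ → ℝ} (h : x =ᵐ[leb] f) : law x = leb.map fun t => |f t| :=
  Measure.map_congr (h.mono fun t ht => by simp only [ht])

theorem law_rearr (x : L0) : law (rearr x) = law x := by
  rw [law_congr (coe_rearr x)]
  simp only [abs_of_nonneg (quantile_nonneg _ _)]
  exact map_quantile _ (law_Iio x)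

/-! ### A criterion for submajorization -/

theorem quantile_eq_zero (ν : Measure ℝ) [IsProbabilityMeasure ν] {t : ℝ} (ht : 1 ≤ t) :
    quantile ν t = 0 := by
  refine le_antisymm ((quantile_le_iff ν (by linarith) le_rfl).2 ?_) (quantile_nonneg _ _)
  exact prob_le_one.trans (ENNReal.one_le_ofReal.2 ht)

theorem lintegral_quantile_law (x : L0) {φ : ℝ → ℝ≥0∞} (hφ : Measurable φ) :
    ∫⁻ t, φ (quantile (law x) t) ∂leb = ∫⁻ t, φ |x t| ∂leb := by
  rw [← lintegral_law x hφ]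
  conv_rhs => rw [← map_quantile (law x) (law_Iio x)]
  rw [lintegral_map hφ (measurable_quantile _)]

theorem measurable_ofReal_sub (l : ℝ) : Measurable fun r : ℝ => ENNReal.ofReal (r - l) :=
  ENNReal.measurable_ofReal.comp (measurable_id.sub_const l)

theorem lintegral_rearrFun (x : L0) (t : ℝ) :
    ∫⁻ s in Ioc 0 t, ENNReal.ofReal (rearrFun x s) =
      ∫⁻ s in Ioc 0 t, ENNReal.ofReal (quantile (law x) s) :=
  setLIntegral_congr_fun measurableSet_Ioc fun s hs => by
    simp only [rearrFun_eq_quantile x hs.1]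

/-- With the next lemma this is the formula ∫₀ᵗ x* = min over l ≥ 0 of lt + ∫(|x| - l)₊, the minimum
being attained at l = x*(t). -/
theorem lintegral_rearrFun_le (x : L0) {l t : ℝ} (hl : 0 ≤ l) :
    ∫⁻ s in Ioc 0 t, ENNReal.ofReal (rearrFun x s) ≤
      ENNReal.ofReal l * ENNReal.ofReal t + ∫⁻ u, ENNReal.ofReal (|x u| - l) ∂leb := by
  have hle : ∀ r : ℝ, ENNReal.ofReal r ≤ ENNReal.ofReal l + ENNReal.ofReal (r - l) := fun r => by
    refine le_trans (le_of_eq ?_) ENNReal.ofReal_add_le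
    ring_nf
  rw [lintegral_rearrFun]
  refine (lintegral_mono fun s => hle _).trans ?_
  rw [lintegral_add_left measurable_const, setLIntegral_const, Real.volume_Ioc, sub_zero]
  refine add_le_add le_rfl ?_
  rw [← lintegral_quantile_law x (measurable_ofReal_sub l)]
  have h1 : ∫⁻ s in Ioc 0 t, ENNReal.ofReal (quantile (law x) s - l) ≤
      ∫⁻ s in Ioi 0, ENNReal.ofReal (quantile (law x) s - l) :=
    lintegral_mono_set fun s hs => hs.1
  refine h1.trans ?_
  have h2 : Ioi (0 : ℝ) = Ioo 0 1 ∪ Ici 1 := (Ioo_union_Ici_eq_Ioi one_pos).symm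
  rw [h2]
  refine (lintegral_union_le _ _ _).trans ?_
  have h3 : ∫⁻ s in Ici 1, ENNReal.ofReal (quantile (law x) s - l) = 0 := by
    rw [setLIntegral_congr_fun (g := fun _ => 0) measurableSet_Ici fun s hs => ?_]
    · simp
    · simp only [quantile_eq_zero (law x) hs, zero_sub]
      exact ENNReal.ofReal_of_nonpos (by linarith)
  rw [h3, add_zero]

theorem le_lintegral_rearrFun (x : L0) {t : ℝ} (ht : 0 < t) :
    ENNReal.ofReal (quantile (law x) t) * ENNReal.ofReal t +
        ∫⁻ u, ENNReal.ofReal (|x u| - quantile (law x) t) ∂leb ≤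
      ∫⁻ s in Ioc 0 t, ENNReal.ofReal (rearrFun x s) := by
  set l := quantile (law x) t with hl
  have hl0 : 0 ≤ l := quantile_nonneg _ _
  rw [lintegral_rearrFun, ← lintegral_quantile_law x (measurable_ofReal_sub l)]
  have h1 : ∫⁻ s, ENNReal.ofReal (quantile (law x) s - l) ∂leb ≤
      ∫⁻ s in Ioc 0 t, ENNReal.ofReal (quantile (law x) s - l) := by
    rw [← lintegral_indicator measurableSet_Ioo, ← lintegral_indicator measurableSet_Ioc]
    refine lintegral_mono fun s => ?_
    by_cases hs : s ∈ Ioo (0 : ℝ) 1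
    · rw [indicator_of_mem hs]
      by_cases hst : s ≤ t
      · rw [indicator_of_mem (show s ∈ Ioc 0 t from ⟨hs.1, hst⟩)]
      · rw [ENNReal.ofReal_of_nonpos
          (sub_nonpos.2 (quantile_anti (law x) ht (not_le.1 hst).le))]
        exact bot_le
    · rw [indicator_of_notMem hs]
      exact bot_le
  refine (add_le_add_right h1 _).trans ?_
  have h2 : ENNReal.ofReal l * ENNReal.ofReal t = ∫⁻ _ in Ioc 0 t, ENNReal.ofReal l := by
    rw [setLIntegral_const, Real.volume_Ioc, sub_zero]
  rw [h2, ← lintegral_add_left measurable_const]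
  refine setLIntegral_mono
    (ENNReal.measurable_ofReal.comp (measurable_quantile _)) fun s hs => ?_
  have hls : l ≤ quantile (law x) s := quantile_anti (law x) hs.1 hs.2
  rw [← ENNReal.ofReal_add hl0 (sub_nonneg.2 hls)]
  ring_nf
  exact le_rfl

/-- `y ≺≺ x` follows from `∫ (|y| - l)₊ ≤ ∫ (|x| - l)₊` for all levels `l ≥ 0`. -/
theorem submajorized_of_lintegral_le {y x : L0}
    (h : ∀ l : ℝ, 0 ≤ l →
      ∫⁻ u, ENNReal.ofReal (|y u| - l) ∂leb ≤ ∫⁻ u, ENNReal.ofReal (|x u| - l) ∂leb) :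
    Submajorized y x := by
  intro t ht
  rcases ht.eq_or_lt with rfl | ht
  · simp
  -- The level is x*(t): there the bound for x is sharp, while the bound for y holds at any level.
  · have hl := quantile_nonneg (law x) t
    exact (lintegral_rearrFun_le y hl).trans
      ((add_le_add_right (h _ hl) _).trans (le_lintegral_rearrFun x ht))

/-! ### Absolute contractions decrease in the sense of submajorization -/

theorem lintegral_abs_coe (f : L1) : ∫⁻ t, ENNReal.ofReal |f t| ∂leb = ‖f‖ₑ := by
  rw [Lp.enorm_def, eLpNorm_one_eq_lintegral_enorm]
  simp only [Real.enorm_eq_ofReal_abs]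

theorem eLpNorm_top_le_iff {f : ℝ → ℝ} {l : ℝ} (hl : 0 ≤ l) :
    eLpNorm f ∞ leb ≤ ENNReal.ofReal l ↔ ∀ᵐ t ∂leb, |f t| ≤ l := by
  rw [eLpNorm_exponent_top]
  constructor
  · intro h
    filter_upwards [ae_le_eLpNormEssSup (f := f) (μ := leb)] with t ht
    have := ht.trans h
    rwa [Real.enorm_eq_ofReal_abs, ENNReal.ofReal_le_ofReal_iff hl] at this
  · intro h
    refine essSup_le_of_ae_le _ ?_
    filter_upwards [h] with t ht
    rw [Real.enorm_eq_ofReal_abs]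
    exact ENNReal.ofReal_le_ofReal ht

/-- Truncation of a real number to `[-l, l]`. -/
def truncate (l r : ℝ) : ℝ := max (-l) (min r l)

theorem measurable_truncate (l : ℝ) : Measurable (truncate l) :=
  measurable_const.max (measurable_id.min measurable_const)

theorem abs_truncate_le {l : ℝ} (hl : 0 ≤ l) (r : ℝ) : |truncate l r| ≤ l := by
  unfold truncate
  rw [abs_le]
  exact ⟨le_max_left _ _, max_le (by linarith) (min_le_right _ _)⟩

theorem abs_truncate {l : ℝ} (hl : 0 ≤ l) (r : ℝ) : |truncate l r| = min |r| l := by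
  unfold truncate
  rcases le_total 0 r with h | h
  · rw [max_eq_right (by have := le_min h hl; linarith), abs_of_nonneg h,
      abs_of_nonneg (le_min h hl)]
  · rw [min_eq_left (h.trans hl), abs_of_nonpos h, abs_of_nonpos (max_le (by linarith) h),
      ← min_neg_neg, neg_neg, min_comm]

theorem abs_sub_truncate {l : ℝ} (hl : 0 ≤ l) (r : ℝ) :
    ENNReal.ofReal |r - truncate l r| = ENNReal.ofReal (|r| - l) := by
  unfold truncate
  rcases le_total 0 r with h | h
  · rw [max_eq_right (by have := le_min h hl; linarith), abs_of_nonneg h]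
    rcases le_total r l with h1 | h1
    · rw [min_eq_left h1, sub_self, abs_zero, ENNReal.ofReal_zero,
        ENNReal.ofReal_of_nonpos (by linarith)]
    · rw [min_eq_right h1, abs_of_nonneg (by linarith)]
  · rw [min_eq_left (h.trans hl), abs_of_nonpos h]
    rcases le_total (-l) r with h1 | h1
    · rw [max_eq_right h1, sub_self, abs_zero, ENNReal.ofReal_zero,
        ENNReal.ofReal_of_nonpos (by linarith)]
    · rw [max_eq_left h1, abs_of_nonpos (by linarith)]
      ring_nf

/-- Truncation of a function. -/
def truncL0 (l : ℝ) (x : L0) : L0 :=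
  AEEqFun.mk (fun t => truncate l (x t))
    ((measurable_truncate l).comp (measurable_coe x)).aestronglyMeasurable

theorem coe_truncL0 (l : ℝ) (x : L0) : truncL0 l x =ᵐ[leb] fun t => truncate l (x t) :=
  AEEqFun.coeFn_mk _ _

theorem mem_L1_iff {x : L0} : x ∈ Lp ℝ 1 leb ↔ ∫⁻ t, ENNReal.ofReal |x t| ∂leb < ∞ := by
  rw [Lp.mem_Lp_iff_eLpNorm_lt_top, eLpNorm_one_eq_lintegral_enorm]
  simp only [Real.enorm_eq_ofReal_abs]

theorem lintegral_ofReal_abs_le_of_bound {x : L0} {l : ℝ} (h : ∀ᵐ t ∂leb, |x t| ≤ l) :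
    ∫⁻ t, ENNReal.ofReal |x t| ∂leb ≤ ENNReal.ofReal l := by
  refine (lintegral_mono_ae (h.mono fun t ht => ENNReal.ofReal_le_ofReal ht)).trans ?_
  simp

theorem mem_L1_of_bound {x : L0} {l : ℝ} (h : ∀ᵐ t ∂leb, |x t| ≤ l) : x ∈ Lp ℝ 1 leb :=
  mem_L1_iff.2 ((lintegral_ofReal_abs_le_of_bound h).trans_lt ENNReal.ofReal_lt_top)

theorem truncL0_bound {l : ℝ} (hl : 0 ≤ l) (x : L0) : ∀ᵐ t ∂leb, |truncL0 l x t| ≤ l := by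
  filter_upwards [coe_truncL0 l x] with t ht
  rw [ht]
  exact abs_truncate_le hl _

/-- Split f into its truncation at l and the rest. The image of the truncation stays bounded by l,
so the excess of Tf over l is controlled by the image of the rest, whose L₁ norm does not grow. -/
theorem lintegral_contraction_sub_le {T : L1 →ₗ[ℝ] L1} (hT : T ∈ absoluteContractions) (f : L1)
    {l : ℝ} (hl : 0 ≤ l) :
    ∫⁻ t, ENNReal.ofReal (|T f t| - l) ∂leb ≤ ∫⁻ t, ENNReal.ofReal (|f t| - l) ∂leb := by
  let g : L1 := ⟨truncL0 l f, mem_L1_of_bound (truncL0_bound hl f)⟩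
  have hTg : ∀ᵐ t ∂leb, |T g t| ≤ l :=
    (eLpNorm_top_le_iff hl).1 ((hT.2 g).trans ((eLpNorm_top_le_iff hl).2 (truncL0_bound hl f)))
  have hsplit : T f = T g + T (f - g) := by rw [← map_add, add_sub_cancel]
  calc ∫⁻ t, ENNReal.ofReal (|T f t| - l) ∂leb
      ≤ ∫⁻ t, ENNReal.ofReal |T (f - g) t| ∂leb := by
        refine lintegral_mono_ae ?_
        have hadd := Lp.coeFn_add (T g) (T (f - g))
        rw [← hsplit] at hadd
        filter_upwards [hadd, hTg] with t ht htg
        refine ENNReal.ofReal_le_ofReal ?_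
        rw [ht, Pi.add_apply]
        have := abs_add_le (T g t) (T (f - g) t)
        linarith
    _ = ‖T (f - g)‖ₑ := lintegral_abs_coe _
    _ ≤ ‖f - g‖ₑ := enorm_le_iff_norm_le.2 (hT.1 _)
    _ = ∫⁻ t, ENNReal.ofReal |(f - g) t| ∂leb := (lintegral_abs_coe _).symm
    _ = ∫⁻ t, ENNReal.ofReal (|f t| - l) ∂leb := by
        refine lintegral_congr_ae ?_
        filter_upwards [Lp.coeFn_sub f g, coe_truncL0 l f] with t ht htg
        rw [ht, Pi.sub_apply, show g t = truncL0 l f t from rfl, htg]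
        exact abs_sub_truncate hl _

theorem lintegral_sub_le_of_mem_orbit {x y : L0} (hy : y ∈ orbit x) {l : ℝ} (hl : 0 ≤ l) :
    ∫⁻ t, ENNReal.ofReal (|y t| - l) ∂leb ≤ ∫⁻ t, ENNReal.ofReal (|x t| - l) ∂leb := by
  obtain ⟨f, rfl, T, hT, rfl⟩ := hy
  exact lintegral_contraction_sub_le hT f hl

theorem mem_L1_of_mem_orbit {x y : L0} (hy : y ∈ orbit x) : x ∈ Lp ℝ 1 leb ∧ y ∈ Lp ℝ 1 leb := by
  obtain ⟨f, rfl, T, hT, rfl⟩ := hy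
  exact ⟨f.2, (T f).2⟩

/-! ### Fully symmetric spaces -/

namespace FunctionSpace

variable {E : FunctionSpace}

theorem enorm_of_mem {f : L0} (h : f ∈ E.carrier) :
    E.enorm f = ENNReal.ofReal ‖(⟨f, h⟩ : E.carrier)‖ := dif_pos h

theorem enorm_coe (f : E.carrier) : E.enorm f = ENNReal.ofReal ‖f‖ := enorm_of_mem f.2

theorem enorm_lt_top_iff {f : L0} : E.enorm f < ∞ ↔ f ∈ E.carrier := by
  unfold enorm
  split_ifs with h <;> simp [h]

theorem enorm_zero : E.enorm 0 = 0 := by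
  rw [enorm_of_mem (zero_mem _)]
  have : (⟨0, zero_mem _⟩ : E.carrier) = 0 := rfl
  rw [this, norm_zero, ENNReal.ofReal_zero]

theorem enorm_smul {f : L0} (h : f ∈ E.carrier) (c : ℝ) :
    E.enorm (c • f) = ENNReal.ofReal |c| * E.enorm f := by
  have := enorm_coe (c • (⟨f, h⟩ : E.carrier))
  rw [norm_smul, Real.norm_eq_abs, ENNReal.ofReal_mul (abs_nonneg c), ← enorm_of_mem] at this
  exact this

theorem enorm_add_le (f g : L0) : E.enorm (f + g) ≤ E.enorm f + E.enorm g := by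
  by_cases hf : f ∈ E.carrier
  · by_cases hg : g ∈ E.carrier
    · have := enorm_coe ((⟨f, hf⟩ : E.carrier) + ⟨g, hg⟩)
      refine le_trans (le_of_eq this) ?_
      rw [enorm_of_mem hf, enorm_of_mem hg, ← ENNReal.ofReal_add (norm_nonneg _) (norm_nonneg _)]
      exact ENNReal.ofReal_le_ofReal (norm_add_le _ _)
    · rw [show E.enorm g = ∞ from dif_neg hg, add_top]
      exact le_top
  · rw [show E.enorm f = ∞ from dif_neg hf, top_add]
    exact le_top

theorem enorm_eq_zero_iff {f : L0} : E.enorm f = 0 ↔ f = 0 := by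
  constructor
  · intro h
    have hf : f ∈ E.carrier := enorm_lt_top_iff.1 (h ▸ ENNReal.zero_lt_top)
    rw [enorm_of_mem hf, ENNReal.ofReal_eq_zero] at h
    exact congrArg Subtype.val (norm_le_zero_iff.1 h)
  · rintro rfl
    exact enorm_zero

theorem IsFullySymmetric.of_lintegral_le (hE : E.IsFullySymmetric) {x y : L0}
    (hx : x ∈ E.carrier) (hy : y ∈ Lp ℝ 1 leb)
    (h : ∀ l : ℝ, 0 ≤ l →
      ∫⁻ u, ENNReal.ofReal (|y u| - l) ∂leb ≤ ∫⁻ u, ENNReal.ofReal (|x u| - l) ∂leb) :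
    y ∈ E.carrier ∧ E.enorm y ≤ E.enorm x :=
  hE.fullySymmetric x hx y hy (submajorized_of_lintegral_le h)

theorem IsFullySymmetric.of_mem_orbit (hE : E.IsFullySymmetric) {x y : L0}
    (hx : x ∈ E.carrier) (hy : y ∈ orbit x) : y ∈ E.carrier ∧ E.enorm y ≤ E.enorm x :=
  hE.of_lintegral_le hx (mem_L1_of_mem_orbit hy).2 fun _ hl => lintegral_sub_le_of_mem_orbit hy hl

theorem IsFullySymmetric.enorm_mono (hE : E.IsFullySymmetric) {x y : L0}
    (h : ∀ᵐ t ∂leb, |y t| ≤ |x t|) : E.enorm y ≤ E.enorm x := by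
  by_cases hx : x ∈ E.carrier
  · exact (hE.ideal x hx y h).2
  · rw [show E.enorm x = ∞ from dif_neg hx]
    exact le_top

/-- The norm of `E` dominates the norm of the constant function with the same integral. -/
theorem IsFullySymmetric.const_of_mem (hE : E.IsFullySymmetric) {x : L0} (hx : x ∈ E.carrier)
    (hx1 : x ∈ Lp ℝ 1 leb) :
    E.enorm (AEEqFun.const ℝ (∫⁻ t, ENNReal.ofReal |x t| ∂leb).toReal) ≤ E.enorm x := by
  set c := ∫⁻ t, ENNReal.ofReal |x t| ∂leb with hc
  have hcoe : (AEEqFun.const ℝ c.toReal : L0) =ᵐ[leb] fun _ => c.toReal :=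
    AEEqFun.coeFn_const _ _
  refine (hE.of_lintegral_le hx (mem_L1_of_bound (l := c.toReal) ?_) fun l hl => ?_).2
  · filter_upwards [hcoe] with t ht
    rw [ht, abs_of_nonneg ENNReal.toReal_nonneg]
  · have h1 : ∫⁻ t, ENNReal.ofReal (|(AEEqFun.const ℝ c.toReal : L0) t| - l) ∂leb =
        ENNReal.ofReal (c.toReal - l) := by
      rw [lintegral_congr_ae (g := fun _ => ENNReal.ofReal (c.toReal - l))]
      · simp
      · filter_upwards [hcoe] with t ht
        rw [ht, abs_of_nonneg ENNReal.toReal_nonneg]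
    -- What remains is Jensen's inequality for r ↦ (r - l)₊, in the form c ≤ l + ∫(|x| - l)₊.
    rw [h1, ENNReal.ofReal_sub _ hl, ENNReal.ofReal_toReal (mem_L1_iff.1 hx1).ne,
      tsub_le_iff_left]
    calc c ≤ ∫⁻ t, (ENNReal.ofReal l + ENNReal.ofReal (|x t| - l)) ∂leb := by
          refine lintegral_mono fun t => le_trans (le_of_eq ?_) ENNReal.ofReal_add_le
          ring_nf
      _ = _ := by
          rw [lintegral_add_left measurable_const]
          simp

theorem abs_truncL0 {l : ℝ} (hl : 0 ≤ l) (x : L0) :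
    ∀ᵐ t ∂leb, |truncL0 l x t| = min |x t| l := by
  filter_upwards [coe_truncL0 l x] with t ht
  rw [ht, abs_truncate hl]

theorem IsFullySymmetric.enorm_truncL0_le (hE : E.IsFullySymmetric) {l : ℝ} (hl : 0 ≤ l)
    (x : L0) : E.enorm (truncL0 l x) ≤ E.enorm x := by
  refine hE.enorm_mono ?_
  filter_upwards [abs_truncL0 hl x] with t ht
  rw [ht]
  exact min_le_left _ _

theorem const_eq_smul_one (c : ℝ) : (AEEqFun.const ℝ c : L0) = c • (1 : L0) := by
  refine AEEqFun.ext ?_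
  filter_upwards [AEEqFun.coeFn_const (μ := leb) ℝ c, AEEqFun.coeFn_smul c (1 : L0),
    AEEqFun.coeFn_one (α := ℝ) (β := ℝ) (μ := leb)] with t h1 h2 h3
  rw [h1, h2, Pi.smul_apply, h3]
  simp

theorem lintegral_abs_eq_zero_iff {x : L0} :
    ∫⁻ t, ENNReal.ofReal |x t| ∂leb = 0 ↔ x = 0 := by
  rw [lintegral_eq_zero_iff (measurable_abs_coe x).ennreal_ofReal]
  constructor
  · intro h
    refine AEEqFun.ext ?_
    filter_upwards [h, AEEqFun.coeFn_zero (α := ℝ) (β := ℝ) (μ := leb)] with t ht h0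
    rw [h0]
    simpa using ht
  · rintro rfl
    filter_upwards [AEEqFun.coeFn_zero (α := ℝ) (β := ℝ) (μ := leb)] with t h0
    rw [h0]
    simp

/-- Integrability of x is not yet available, so x is first truncated at 1. The truncation is still
nonzero, and the constant equal to its L₁ norm lies in E by full symmetry. -/
theorem IsFullySymmetric.one_mem (hE : E.IsFullySymmetric) {x : L0} (hx : x ∈ E.carrier)
    (h0 : x ≠ 0) : (1 : L0) ∈ E.carrier := by
  have hx' : truncL0 1 x ∈ E.carrier := enorm_lt_top_iff.1
    ((hE.enorm_truncL0_le zero_le_one x).trans_lt (enorm_lt_top_iff.2 hx))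
  have hx1 : truncL0 1 x ∈ Lp ℝ 1 leb := mem_L1_of_bound (truncL0_bound zero_le_one x)
  have h := hE.const_of_mem hx' hx1
  set c := (∫⁻ t, ENNReal.ofReal |truncL0 1 x t| ∂leb).toReal with hc
  have hmem : (AEEqFun.const ℝ c : L0) ∈ E.carrier :=
    enorm_lt_top_iff.1 (h.trans_lt (enorm_lt_top_iff.2 hx'))
  have hc0 : c ≠ 0 := by
    rw [hc, ENNReal.toReal_ne_zero]
    refine ⟨fun h => h0 ?_, (mem_L1_iff.1 hx1).ne⟩
    rw [lintegral_abs_eq_zero_iff] at h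
    refine AEEqFun.ext ?_
    have h2 := abs_truncL0 zero_le_one x
    rw [h] at h2
    filter_upwards [h2, AEEqFun.coeFn_zero (α := ℝ) (β := ℝ) (μ := leb)] with t ht h0
    rw [h0] at ht ⊢
    simp only [Pi.zero_apply, abs_zero] at ht ⊢
    rcases min_choice |x t| 1 with h | h
    · rw [h] at ht
      exact abs_eq_zero.1 ht.symm
    · rw [h] at ht
      exact absurd ht zero_ne_one
  rw [const_eq_smul_one] at hmem
  have := E.carrier.smul_mem c⁻¹ hmem
  rwa [smul_smul, inv_mul_cancel₀ hc0, one_smul] at this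

/-- The bound holds for the truncations of x at n, uniformly in n, and passes to x by monotone
convergence; this is what makes members of E integrable. -/
theorem IsFullySymmetric.lintegral_mul_le (hE : E.IsFullySymmetric)
    (h1 : (1 : L0) ∈ E.carrier) (x : L0) :
    (∫⁻ t, ENNReal.ofReal |x t| ∂leb) * E.enorm 1 ≤ E.enorm x := by
  by_cases hx : x ∈ E.carrier
  swap
  · rw [show E.enorm x = ∞ from dif_neg hx]
    exact le_top
  have hbd : ∀ n : ℕ, (∫⁻ t, ENNReal.ofReal (min |x t| n) ∂leb) * E.enorm 1 ≤ E.enorm x := by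
    intro n
    have hn : (0 : ℝ) ≤ n := n.cast_nonneg
    have hxn : truncL0 n x ∈ E.carrier := enorm_lt_top_iff.1
      ((hE.enorm_truncL0_le hn x).trans_lt (enorm_lt_top_iff.2 hx))
    have hxn1 : truncL0 n x ∈ Lp ℝ 1 leb := mem_L1_of_bound (truncL0_bound hn x)
    have h := (hE.const_of_mem hxn hxn1).trans (hE.enorm_truncL0_le hn x)
    rw [const_eq_smul_one, enorm_smul h1, abs_of_nonneg ENNReal.toReal_nonneg,
      ENNReal.ofReal_toReal (mem_L1_iff.1 hxn1).ne] at h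
    refine le_trans (le_of_eq ?_) h
    congr 1
    refine lintegral_congr_ae ?_
    filter_upwards [abs_truncL0 hn x] with t ht
    rw [ht]
  have hlim : Tendsto (fun n : ℕ => ∫⁻ t, ENNReal.ofReal (min |x t| n) ∂leb) atTop
      (𝓝 (∫⁻ t, ENNReal.ofReal |x t| ∂leb)) := by
    refine lintegral_tendsto_of_tendsto_of_monotone (fun n => ?_) ?_ ?_
    · exact (ENNReal.measurable_ofReal.comp
        ((measurable_abs_coe x).min measurable_const)).aemeasurable
    · refine ae_of_all _ fun t m n hmn => ENNReal.ofReal_le_ofReal ?_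
      exact min_le_min le_rfl (by exact_mod_cast hmn)
    · refine ae_of_all _ fun t => ?_
      refine tendsto_const_nhds.congr' ?_
      filter_upwards [eventually_ge_atTop ⌈|x t|⌉₊] with n hn
      rw [min_eq_left (Nat.ceil_le.1 hn)]
  refine le_of_tendsto (ENNReal.Tendsto.mul_const hlim (Or.inr (enorm_lt_top_iff.2 h1).ne))
    (Eventually.of_forall hbd)

/-- `E` embeds continuously into `L₁`. -/
theorem IsFullySymmetric.exists_lintegral_le (hE : E.IsFullySymmetric) :
    ∃ C : ℝ≥0∞, C ≠ ∞ ∧ ∀ x ∈ E.carrier, ∫⁻ t, ENNReal.ofReal |x t| ∂leb ≤ C * E.enorm x := by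
  by_cases h : ∃ x ∈ E.carrier, x ≠ 0
  · obtain ⟨x, hx, h0⟩ := h
    have h1 := hE.one_mem hx h0
    have hne : E.enorm 1 ≠ 0 := by
      rw [Ne, enorm_eq_zero_iff]
      intro h
      have : ∀ᵐ t ∂leb, (1 : ℝ) = 0 := by
        filter_upwards [AEEqFun.coeFn_zero (α := ℝ) (β := ℝ) (μ := leb),
          AEEqFun.coeFn_one (α := ℝ) (β := ℝ) (μ := leb)] with t ht0 ht1
        rw [h, ht0] at ht1
        exact ht1.symm
      obtain ⟨_, h⟩ := this.exists
      exact one_ne_zero h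
    refine ⟨(E.enorm 1)⁻¹, ENNReal.inv_ne_top.2 hne, fun y _ => ?_⟩
    rw [mul_comm, ← div_eq_mul_inv, ENNReal.le_div_iff_mul_le (Or.inl hne)
      (Or.inl (enorm_lt_top_iff.2 h1).ne)]
    exact hE.lintegral_mul_le h1 y
  · push Not at h
    refine ⟨0, ENNReal.zero_ne_top, fun x hx => ?_⟩
    rw [h x hx, zero_mul]
    exact (lintegral_abs_eq_zero_iff.2 rfl).le

/-- Bounded members of `E` have norm controlled by their supremum. -/
theorem IsFullySymmetric.exists_enorm_le_of_bound (hE : E.IsFullySymmetric) :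
    ∃ C : ℝ≥0∞, C ≠ ∞ ∧ ∀ x ∈ E.carrier, ∀ l : ℝ, (∀ᵐ t ∂leb, |x t| ≤ l) →
      E.enorm x ≤ C * ENNReal.ofReal l := by
  by_cases h : ∃ x ∈ E.carrier, x ≠ 0
  · obtain ⟨x, hx, h0⟩ := h
    have h1 := hE.one_mem hx h0
    refine ⟨E.enorm 1, (enorm_lt_top_iff.2 h1).ne, fun y _ l hl => ?_⟩
    have hl0 : 0 ≤ l := by
      obtain ⟨t, ht⟩ := hl.exists
      exact (abs_nonneg _).trans ht
    have := enorm_smul h1 l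
    rw [abs_of_nonneg hl0, mul_comm] at this
    rw [← this, ← const_eq_smul_one]
    refine hE.enorm_mono ?_
    filter_upwards [hl, AEEqFun.coeFn_const (μ := leb) ℝ l] with t ht htl
    rw [htl, Function.const_apply, abs_of_nonneg hl0]
    exact ht
  · push Not at h
    refine ⟨0, ENNReal.zero_ne_top, fun x hx l _ => ?_⟩
    rw [h x hx, zero_mul, enorm_zero]

end FunctionSpace

/-! ### Duality between `L₁` and bounded functions -/

/-- The sign of a real number, with value `1` at `0`. -/
def sgn (r : ℝ) : ℝ := if 0 ≤ r then 1 else -1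

theorem measurable_sgn : Measurable sgn :=
  Measurable.ite measurableSet_Ici measurable_const measurable_const

theorem abs_sgn (r : ℝ) : |sgn r| = 1 := by unfold sgn; split_ifs <;> simp

theorem mul_sgn (r : ℝ) : r * sgn r = |r| := by
  unfold sgn
  split_ifs with h
  · rw [mul_one, abs_of_nonneg h]
  · rw [mul_neg_one, abs_of_neg (not_le.1 h)]

theorem sgn_mul_abs (r : ℝ) : sgn r * |r| = r := by
  unfold sgn
  split_ifs with h
  · rw [one_mul, abs_of_nonneg h]
  · rw [abs_of_neg (not_le.1 h)]
    ring

theorem integrable_coe (f : L1) : Integrable f leb := L1.integrable_coeFn f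

theorem norm_eq_integral_abs (f : L1) : ‖f‖ = ∫ t, |f t| ∂leb := L1.norm_eq_integral_norm f

theorem integrable_mul_of_bound {f : ℝ → ℝ} (hf : Integrable f leb) {g : ℝ → ℝ}
    (hg : Measurable g) {l : ℝ} (hl : ∀ t, |g t| ≤ l) : Integrable (fun t => f t * g t) leb :=
  hf.mul_bdd (c := l) hg.aestronglyMeasurable (ae_of_all _ hl)

/-- Measurable functions bounded by one. -/
abbrev UnitFun : Type := {g : ℝ → ℝ // Measurable g ∧ ∀ t, |g t| ≤ 1}

theorem abs_integral_mul_le (f : L1) (g : UnitFun) : |∫ t, f t * g.1 t ∂leb| ≤ ‖f‖ := by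
  rw [norm_eq_integral_abs]
  refine (abs_integral_le_integral_abs).trans (integral_mono_of_nonneg
    (ae_of_all _ fun _ => abs_nonneg _) (integrable_coe f).abs (ae_of_all _ fun t => ?_))
  simp only [abs_mul]
  exact mul_le_of_le_one_right (abs_nonneg _) (g.2.2 t)

/-- The functional `f ↦ ∫ f g` on `L₁`. -/
def pairing (g : UnitFun) : L1 →L[ℝ] ℝ :=
  LinearMap.mkContinuous
    { toFun := fun f => ∫ t, f t * g.1 t ∂leb
      map_add' := fun f₁ f₂ => by
        rw [← integral_add (integrable_mul_of_bound (integrable_coe f₁) g.2.1 g.2.2)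
          (integrable_mul_of_bound (integrable_coe f₂) g.2.1 g.2.2)]
        refine integral_congr_ae ?_
        filter_upwards [Lp.coeFn_add f₁ f₂] with t ht
        rw [ht, Pi.add_apply, add_mul]
      map_smul' := fun c f => by
        rw [RingHom.id_apply, smul_eq_mul, ← integral_const_mul]
        refine integral_congr_ae ?_
        filter_upwards [Lp.coeFn_smul c f] with t ht
        rw [ht, Pi.smul_apply, smul_eq_mul, mul_assoc] } 1
    fun f => by rw [one_mul]; exact abs_integral_mul_le f g

theorem pairing_apply (g : UnitFun) (f : L1) : pairing g f = ∫ t, f t * g.1 t ∂leb := rfl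

theorem abs_pairing_le (g : UnitFun) (f : L1) : |pairing g f| ≤ ‖f‖ := abs_integral_mul_le f g

theorem norm_le_of_pairing_le {f : L1} {C : ℝ} (h : ∀ g, pairing g f ≤ C) : ‖f‖ ≤ C := by
  have := h ⟨fun t => sgn (f t), measurable_sgn.comp (measurable_coe (f : L0)),
    fun t => (abs_sgn _).le⟩
  rw [pairing_apply] at this
  simp only [mul_sgn] at this
  rwa [norm_eq_integral_abs]

theorem eq_of_pairing_eq {f₁ f₂ : L1} (h : ∀ g, pairing g f₁ = pairing g f₂) : f₁ = f₂ := by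
  rw [← sub_eq_zero, ← norm_le_zero_iff]
  exact norm_le_of_pairing_le fun g => by rw [map_sub, h g, sub_self]

theorem pairing_le_of_bound {f : L1} {l : ℝ} (hl : ∀ᵐ t ∂leb, |f t| ≤ l) (g : UnitFun) :
    pairing g f ≤ l * ∫ t, |g.1 t| ∂leb := by
  rw [pairing_apply, ← integral_const_mul]
  have hint : Integrable (fun t => |g.1 t|) leb := by
    have := integrable_mul_of_bound (integrable_const (1 : ℝ)) g.2.1 g.2.2
    simpa using this.abs
  refine integral_mono_ae (integrable_mul_of_bound (integrable_coe f) g.2.1 g.2.2)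
    (hint.const_mul l) ?_
  filter_upwards [hl] with t ht
  refine (le_abs_self _).trans ?_
  rw [abs_mul]
  exact mul_le_mul_of_nonneg_right ht (abs_nonneg _)

/-- Testing with sgn f on {|f| > l} shows that the integral of |f| - l over this set is at most 0,
so the set is null. Together with `pairing_le_of_bound` this lets uniform bounds pass to weak
limits. -/
theorem bound_of_pairing_le {f : L1} {l : ℝ} (h : ∀ g, pairing g f ≤ l * ∫ t, |g.1 t| ∂leb) :
    ∀ᵐ t ∂leb, |f t| ≤ l := by
  have hS : MeasurableSet {t | l < |f t|} :=
    measurableSet_lt measurable_const (measurable_abs_coe (f : L0))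
  have h1 := h ⟨{t | l < |f t|}.indicator fun t => sgn (f t),
    (measurable_sgn.comp (measurable_coe (f : L0))).indicator hS, fun t => by
      by_cases ht : t ∈ {t | l < |f t|}
      · rw [indicator_of_mem ht, abs_sgn]
      · rw [indicator_of_notMem ht, abs_zero]; exact zero_le_one⟩
  have e1 : ∀ t, f t * {t | l < |f t|}.indicator (fun t => sgn (f t)) t =
      {t | l < |f t|}.indicator (fun t => |f t|) t := fun t => by
    by_cases ht : t ∈ {t | l < |f t|}
    · rw [indicator_of_mem ht, indicator_of_mem ht, mul_sgn]
    · rw [indicator_of_notMem ht, indicator_of_notMem ht, mul_zero]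
  have e2 : ∀ t, |{t | l < |f t|}.indicator (fun t => sgn (f t)) t| =
      {t | l < |f t|}.indicator (fun _ => 1) t := fun t => by
    by_cases ht : t ∈ {t | l < |f t|}
    · rw [indicator_of_mem ht, indicator_of_mem ht, abs_sgn]
    · rw [indicator_of_notMem ht, indicator_of_notMem ht, abs_zero]
  rw [pairing_apply] at h1
  simp only [e1, e2] at h1
  rw [integral_indicator hS, integral_indicator hS, ← integral_const_mul, ← sub_nonpos,
    ← integral_sub (integrable_coe f).abs.integrableOn (integrable_const (l * 1))] at h1
  have h2 : ∀ᵐ t ∂(leb.restrict {t | l < |f t|}), 0 ≤ |f t| - l * 1 := by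
    filter_upwards [ae_restrict_mem hS] with t ht
    have : l < |f t| := ht
    linarith
  have h3 := (integral_eq_zero_iff_of_nonneg_ae h2
    ((integrable_coe f).abs.integrableOn.sub (integrable_const (l * 1)))).1
    (le_antisymm h1 (integral_nonneg_of_ae h2))
  have h4 := (ae_restrict_iff' hS).1 h3
  filter_upwards [h4] with t ht
  by_contra hlt
  have hlt := not_le.1 hlt
  have := ht hlt
  simp only [Pi.zero_apply] at this
  linarith

/-- Truncations of an integrable function, as elements of `L₁`. -/
def truncL1 (l : ℝ) (hl : 0 ≤ l) (f : L1) : L1 :=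
  ⟨truncL0 l f, mem_L1_of_bound (truncL0_bound hl f)⟩

theorem tendsto_truncL1 (f : L1) :
    Tendsto (fun n : ℕ => truncL1 n n.cast_nonneg f) atTop (𝓝 f) := by
  rw [tendsto_iff_edist_tendsto_0]
  have h1 : ∀ n : ℕ, edist (truncL1 n n.cast_nonneg f) f =
      ∫⁻ t, ENNReal.ofReal (|f t| - n) ∂leb := by
    intro n
    rw [edist_comm, edist_eq_enorm_sub, ← lintegral_abs_coe]
    refine lintegral_congr_ae ?_
    filter_upwards [Lp.coeFn_sub f (truncL1 n n.cast_nonneg f), coe_truncL0 n f] with t ht htg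
    rw [ht, Pi.sub_apply, show truncL1 n n.cast_nonneg f t = truncL0 n f t from rfl, htg]
    exact abs_sub_truncate n.cast_nonneg _
  simp only [h1]
  rw [← lintegral_zero (μ := leb)]
  refine tendsto_lintegral_of_dominated_convergence (fun t => ENNReal.ofReal |f t|)
    (fun n => (measurable_ofReal_sub n).comp (measurable_abs_coe (f : L0)))
    (fun n => ae_of_all _ fun t => ENNReal.ofReal_le_ofReal ?_) ?_ (ae_of_all _ fun t => ?_)
  · have : (0 : ℝ) ≤ n := n.cast_nonneg
    linarith
  · exact (mem_L1_iff.1 f.2).ne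
  · refine tendsto_const_nhds.congr' ?_
    filter_upwards [eventually_ge_atTop ⌈|f t|⌉₊] with n hn
    rw [ENNReal.ofReal_of_nonpos (sub_nonpos.2 (Nat.ceil_le.1 hn))]

/-! ### Orbits are closed in `L₁` -/

/-- `h` is the weak limit of the functions `T n f` along an ultrafilter. -/
def IsWeakLimit (𝒰 : Ultrafilter ℕ) (u : ℕ → L1) (h : L1) : Prop :=
  ∀ g, Tendsto (fun n => pairing g (u n)) 𝒰 (𝓝 (pairing g h))

theorem IsWeakLimit.unique {𝒰 : Ultrafilter ℕ} {u : ℕ → L1} {h₁ h₂ : L1}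
    (H₁ : IsWeakLimit 𝒰 u h₁) (H₂ : IsWeakLimit 𝒰 u h₂) : h₁ = h₂ :=
  eq_of_pairing_eq fun g => tendsto_nhds_unique (H₁ g) (H₂ g)

theorem IsWeakLimit.norm_le {𝒰 : Ultrafilter ℕ} {u : ℕ → L1} {h : L1}
    (H : IsWeakLimit 𝒰 u h) {C : ℝ} (hC : ∀ n, ‖u n‖ ≤ C) : ‖h‖ ≤ C :=
  norm_le_of_pairing_le fun g => le_of_tendsto (H g) (Eventually.of_forall fun n =>
    (le_abs_self _).trans ((abs_pairing_le g _).trans (hC n)))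

theorem IsWeakLimit.bound {𝒰 : Ultrafilter ℕ} {u : ℕ → L1} {h : L1}
    (H : IsWeakLimit 𝒰 u h) {l : ℝ} (hl : ∀ n, ∀ᵐ t ∂leb, |u n t| ≤ l) :
    ∀ᵐ t ∂leb, |h t| ≤ l :=
  bound_of_pairing_le fun g => le_of_tendsto (H g) (Eventually.of_forall fun n =>
    pairing_le_of_bound (hl n) g)

/-- The sequence is bounded in L₂, where Banach–Alaoglu and the Riesz representation provide a limit
along the ultrafilter; bounded test functions belong to L₂. -/
theorem exists_isWeakLimit_of_bound (𝒰 : Ultrafilter ℕ) {u : ℕ → L1} {l : ℝ}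
    (hl : ∀ n, ∀ᵐ t ∂leb, |u n t| ≤ l) : ∃ h, IsWeakLimit 𝒰 u h := by
  have hl0 : 0 ≤ l := by
    obtain ⟨t, ht⟩ := (hl 0).exists
    exact (abs_nonneg _).trans ht
  have hmem : ∀ n, MemLp (u n) 2 leb := fun n =>
    MemLp.of_bound (measurable_coe (u n : L0)).aestronglyMeasurable l (hl n)
  let v : ℕ → Lp ℝ 2 leb := fun n => (hmem n).toLp (u n)
  have hv : ∀ n, ‖v n‖ ≤ l := fun n => by
    have := Lp.norm_le_of_ae_bound (f := v n) hl0 (by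
      filter_upwards [(hmem n).coeFn_toLp, hl n] with t ht htl
      rw [ht]
      exact htl)
    simpa [measureUnivNNReal] using this
  let φ : ℕ → WeakDual ℝ (Lp ℝ 2 leb) := fun n =>
    StrongDual.toWeakDual (InnerProductSpace.toDual ℝ _ (v n))
  obtain ⟨a, -, ha⟩ := (WeakDual.isCompact_closedBall (𝕜 := ℝ)
    (0 : StrongDual ℝ (Lp ℝ 2 leb)) l).ultrafilter_le_nhds (𝒰.map φ) (by
      rw [le_principal_iff]
      refine Filter.mem_map.2 (Filter.Eventually.of_forall fun n => ?_)
      simp [φ, hv n])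
  let h : Lp ℝ 2 leb := (InnerProductSpace.toDual ℝ _).symm (WeakDual.toStrongDual a)
  have hmem1 : MemLp h 1 leb := (Lp.memLp h).mono_exponent (by norm_num)
  refine ⟨hmem1.toLp h, fun g => ?_⟩
  have hg : MemLp g.1 2 leb :=
    MemLp.of_bound g.2.1.aestronglyMeasurable 1 (ae_of_all _ g.2.2)
  have e1 : ∀ n, φ n (hg.toLp g.1) = pairing g (u n) := fun n => by
    change InnerProductSpace.toDual ℝ _ (v n) (hg.toLp g.1) = _
    rw [InnerProductSpace.toDual_apply_apply, L2.inner_def, pairing_apply]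
    refine integral_congr_ae ?_
    filter_upwards [(hmem n).coeFn_toLp, hg.coeFn_toLp] with t h1 h2
    rw [h1, h2]
    simp [mul_comm]
  have e2 : a (hg.toLp g.1) = pairing g (hmem1.toLp h) := by
    have : InnerProductSpace.toDual ℝ _ h (hg.toLp g.1) = a (hg.toLp g.1) := by
      simp [h]
    rw [← this, InnerProductSpace.toDual_apply_apply, L2.inner_def, pairing_apply]
    refine integral_congr_ae ?_
    filter_upwards [hmem1.coeFn_toLp, hg.coeFn_toLp] with t h1 h2
    rw [h1, h2]
    simp [mul_comm]
  rw [← e2]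
  simp only [← e1]
  exact ((WeakDual.eval_continuous (hg.toLp g.1)).tendsto a).comp ha

/-- For bounded f the images are uniformly bounded. In general the weak limits for the truncations
of f form a Cauchy sequence in L₁, since the operators contract and the norm is weakly lower
semicontinuous; its limit serves for f by an ε/3 argument. -/
theorem exists_isWeakLimit (𝒰 : Ultrafilter ℕ) {T : ℕ → L1 →ₗ[ℝ] L1}
    (hT : ∀ n, T n ∈ absoluteContractions) (f : L1) : ∃ h, IsWeakLimit 𝒰 (fun n => T n f) h := by
  have hex : ∀ k : ℕ, ∃ h, IsWeakLimit 𝒰 (fun n => T n (truncL1 k k.cast_nonneg f)) h := by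
    intro k
    refine exists_isWeakLimit_of_bound 𝒰 (l := k) fun n => ?_
    exact (eLpNorm_top_le_iff k.cast_nonneg).1 (((hT n).2 _).trans
      ((eLpNorm_top_le_iff k.cast_nonneg).2 (truncL0_bound k.cast_nonneg f)))
  choose h hh using hex
  have hlim := tendsto_truncL1 f
  have hdist : ∀ k l, dist (h k) (h l) ≤
      dist (truncL1 k k.cast_nonneg f) (truncL1 l l.cast_nonneg f) := by
    intro k l
    rw [dist_eq_norm, dist_eq_norm]
    refine IsWeakLimit.norm_le (𝒰 := 𝒰)
      (u := fun n => T n (truncL1 k k.cast_nonneg f - truncL1 l l.cast_nonneg f))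
      (fun g => ?_) fun n => (hT n).1 _
    simp only [map_sub]
    exact (hh k g).sub (hh l g)
  have hcauchy : CauchySeq h := by
    have := hlim.cauchySeq
    rw [Metric.cauchySeq_iff] at this ⊢
    intro ε hε
    obtain ⟨N, hN⟩ := this ε hε
    exact ⟨N, fun m hm n hn => (hdist m n).trans_lt (hN m hm n hn)⟩
  obtain ⟨H, hH⟩ := cauchySeq_tendsto_of_complete hcauchy
  refine ⟨H, fun g => ?_⟩
  rw [Metric.tendsto_nhds]
  intro ε hε
  obtain ⟨k, hk1, hk2⟩ := ((Metric.tendsto_nhds.1 hlim (ε / 3) (by positivity)).and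
    (Metric.tendsto_nhds.1 hH (ε / 3) (by positivity))).exists
  filter_upwards [Metric.tendsto_nhds.1 (hh k g) (ε / 3) (by positivity)] with n hn
  rw [dist_eq_norm] at hk1 hk2
  have h1 : |pairing g (T n (truncL1 k k.cast_nonneg f - f))| ≤ _ :=
    (abs_pairing_le g _).trans ((hT n).1 _)
  have h2 := abs_pairing_le g (h k - H)
  rw [map_sub, map_sub] at h1
  rw [map_sub] at h2
  rw [Real.dist_eq, abs_lt] at hn ⊢
  rw [abs_le] at h1 h2
  constructor <;> linarith

theorem IsWeakLimit.add {𝒰 : Ultrafilter ℕ} {u v : ℕ → L1} {h k : L1} (H : IsWeakLimit 𝒰 u h)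
    (K : IsWeakLimit 𝒰 v k) : IsWeakLimit 𝒰 (fun n => u n + v n) (h + k) := fun g => by
  simp only [map_add]
  exact (H g).add (K g)

theorem IsWeakLimit.smul {𝒰 : Ultrafilter ℕ} {u : ℕ → L1} {h : L1} (H : IsWeakLimit 𝒰 u h)
    (c : ℝ) : IsWeakLimit 𝒰 (fun n => c • u n) (c • h) := fun g => by
  simp only [map_smul]
  exact (H g).const_smul c

/-- Every sequence of absolute contractions has a limit point in the weak operator topology. -/
theorem exists_weak_limit_contraction (𝒰 : Ultrafilter ℕ) {T : ℕ → L1 →ₗ[ℝ] L1}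
    (hT : ∀ n, T n ∈ absoluteContractions) :
    ∃ S ∈ absoluteContractions, ∀ f, IsWeakLimit 𝒰 (fun n => T n f) (S f) := by
  -- One ultrafilter serves all f at once, so uniqueness of limits makes S linear.
  choose S hS using exists_isWeakLimit 𝒰 hT
  let S' : L1 →ₗ[ℝ] L1 :=
    { toFun := S
      map_add' := fun f₁ f₂ => by
        refine (hS (f₁ + f₂)).unique ?_
        simp only [map_add]
        exact (hS f₁).add (hS f₂)
      map_smul' := fun c f => by
        refine (hS (c • f)).unique ?_
        simp only [map_smul]
        exact (hS f).smul c }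
  refine ⟨S', ⟨fun f => (hS f).norm_le fun n => (hT n).1 f, fun f => ?_⟩, hS⟩
  by_cases htop : eLpNorm f ∞ leb = ∞
  · rw [htop]
    exact le_top
  · rw [← ENNReal.ofReal_toReal htop, eLpNorm_top_le_iff ENNReal.toReal_nonneg]
    refine (hS f).bound fun n => ?_
    rw [← eLpNorm_top_le_iff ENNReal.toReal_nonneg, ENNReal.ofReal_toReal htop]
    exact (hT n).2 f

/-- If T_n f converges to y in norm, a weak operator limit S of the T_n satisfies S f = y. -/
theorem isClosed_orbit (x : L0) : IsClosed {f : L1 | (f : L0) ∈ orbit x} := by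
  refine IsSeqClosed.isClosed fun u y hu hy => ?_
  obtain ⟨f, hf, -⟩ := hu 0
  have hT : ∀ n, ∃ T ∈ absoluteContractions, T f = u n := fun n => by
    obtain ⟨f', hf', T, hT, hTf⟩ := hu n
    have : f' = f := Subtype.ext (hf'.trans hf.symm)
    subst this
    exact ⟨T, hT, Subtype.ext hTf⟩
  choose T hT hTf using hT
  obtain ⟨S, hS, hSw⟩ := exists_weak_limit_contraction (hyperfilter ℕ) hT
  refine ⟨f, hf, S, hS, congrArg Subtype.val ((hSw f).unique fun g => ?_)⟩
  simp only [hTf]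
  exact ((pairing g).continuous.tendsto y).comp
    (hy.mono_left ((hyperfilter_le_cofinite (α := ℕ)).trans Nat.cofinite_eq_atTop.le))

/-- A function that is approximated in `L₁` by members of the orbit is in the orbit. -/
theorem mem_orbit_of_approx {x y : L0} (hy : y ∈ Lp ℝ 1 leb)
    (h : ∀ ε : ℝ≥0∞, 0 < ε → ∃ z ∈ orbit x, ∫⁻ t, ENNReal.ofReal |y t - z t| ∂leb < ε) :
    y ∈ orbit x := by
  have hmem : (⟨y, hy⟩ : L1) ∈ closure {f : L1 | (f : L0) ∈ orbit x} := by
    rw [EMetric.mem_closure_iff]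
    intro ε hε
    obtain ⟨z, hz, hyz⟩ := h ε hε
    refine ⟨⟨z, (mem_L1_of_mem_orbit hz).2⟩, hz, ?_⟩
    rw [edist_eq_enorm_sub, ← lintegral_abs_coe]
    refine lt_of_eq_of_lt (lintegral_congr_ae ?_) hyz
    filter_upwards [Lp.coeFn_sub (⟨y, hy⟩ : L1) ⟨z, (mem_L1_of_mem_orbit hz).2⟩] with t ht
    rw [ht, Pi.sub_apply]
  rwa [(isClosed_orbit x).closure_eq] at hmem

theorem orbit_convex (x : L0) : Convex ℝ (orbit x) := by
  rintro _ ⟨f, hf, T, hT, rfl⟩ _ ⟨f', hf', S, hS, rfl⟩ a b ha hb hab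
  have : f' = f := Subtype.ext (hf'.trans hf.symm)
  subst this
  refine ⟨f', hf, a • T + b • S, ⟨fun g => ?_, fun g => ?_⟩, rfl⟩
  · rw [LinearMap.add_apply, LinearMap.smul_apply, LinearMap.smul_apply]
    refine (norm_add_le _ _).trans ?_
    rw [norm_smul, norm_smul, Real.norm_of_nonneg ha, Real.norm_of_nonneg hb]
    calc a * ‖T g‖ + b * ‖S g‖ ≤ a * ‖g‖ + b * ‖g‖ := by
          gcongr
          exacts [hT.1 g, hS.1 g]
      _ = ‖g‖ := by rw [← add_mul, hab, one_mul]
  · by_cases htop : eLpNorm g ∞ leb = ∞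
    · rw [htop]
      exact le_top
    · set l := (eLpNorm g ∞ leb).toReal with hl
      have hl0 : 0 ≤ l := ENNReal.toReal_nonneg
      have hT' := hT.2 g
      have hS' := hS.2 g
      rw [← ENNReal.ofReal_toReal htop, ← hl, eLpNorm_top_le_iff hl0] at hT' hS' ⊢
      filter_upwards [hT', hS', Lp.coeFn_add (a • T g) (b • S g), Lp.coeFn_smul a (T g),
        Lp.coeFn_smul b (S g)] with t h1 h2 h3 h4 h5
      rw [LinearMap.add_apply, LinearMap.smul_apply, LinearMap.smul_apply, h3, Pi.add_apply, h4, h5,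
        Pi.smul_apply, Pi.smul_apply, smul_eq_mul, smul_eq_mul]
      refine (abs_add_le _ _).trans ?_
      rw [abs_mul, abs_mul, abs_of_nonneg ha, abs_of_nonneg hb]
      calc a * |T g t| + b * |S g t| ≤ a * l + b * l := by gcongr
        _ = l := by rw [← add_mul, hab, one_mul]

/-! ### Equimeasurable functions lie in the orbit -/

/-- The index of the level interval `[kε, (k+1)ε)` containing `|x t|`. -/
def cell (ε : ℝ) (x : L0) (t : ℝ) : ℕ := ⌊|x t| / ε⌋₊

theorem measurable_cell (ε : ℝ) (x : L0) : Measurable (cell ε x) :=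
  Nat.measurable_floor.comp ((measurable_abs_coe x).div_const ε)

theorem cell_bounds {ε : ℝ} (hε : 0 < ε) (x : L0) (t : ℝ) :
    cell ε x t * ε ≤ |x t| ∧ |x t| < cell ε x t * ε + ε := by
  have h0 : 0 ≤ |x t| / ε := by positivity
  have h1 := Nat.floor_le h0
  have h2 := Nat.lt_floor_add_one (|x t| / ε)
  rw [le_div_iff₀ hε] at h1
  rw [div_lt_iff₀ hε] at h2
  refine ⟨h1, h2.trans_eq ?_⟩
  rw [add_mul, one_mul]
  rfl

theorem tsum_lintegral_fiber {κ : ℝ → ℕ} (hκ : Measurable κ) (φ : ℝ → ℝ≥0∞) :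
    ∑' k, ∫⁻ t in κ ⁻¹' {k}, φ t ∂leb = ∫⁻ t, φ t ∂leb := by
  rw [← lintegral_iUnion (fun k => hκ (measurableSet_singleton k))
    (fun i j hij => Disjoint.preimage _ (disjoint_singleton.2 hij)), ← preimage_iUnion,
    iUnion_of_singleton, preimage_univ, setLIntegral_univ]

theorem tsum_fiber {κ : ℝ → ℕ} (hκ : Measurable κ) : ∑' k, leb (κ ⁻¹' {k}) = 1 := by
  have := tsum_lintegral_fiber hκ fun _ => 1
  rw [lintegral_one, measure_univ] at this
  simpa only [setLIntegral_one] using this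

theorem lintegral_comp_nat {κ : ℝ → ℕ} (hκ : Measurable κ) (φ : ℕ → ℝ≥0∞) :
    ∫⁻ t, φ (κ t) ∂leb = ∑' k, φ k * leb (κ ⁻¹' {k}) := by
  rw [← tsum_lintegral_fiber hκ]
  refine tsum_congr fun k => ?_
  rw [setLIntegral_congr_fun (g := fun _ => φ k) (hκ (measurableSet_singleton k)) fun t ht => ?_]
  · rw [setLIntegral_const]
  · rw [show κ t = k from ht]

theorem ae_fiber_ne_zero {κ : ℝ → ℕ} (hκ : Measurable κ) : ∀ᵐ t ∂leb, leb (κ ⁻¹' {κ t}) ≠ 0 := by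
  have h : ∀ᵐ k ∂(leb.map κ), (leb.map κ) {k} ≠ 0 := by
    rw [ae_iff_of_countable]
    exact fun k hk => hk
  filter_upwards [ae_of_ae_map hκ.aemeasurable h] with t ht
  rwa [Measure.map_apply hκ (measurableSet_singleton _)] at ht

/-- The sign of `x` on a level set. -/
def cellSign (ε : ℝ) (x : L0) (k : ℕ) : UnitFun :=
  ⟨(cell ε x ⁻¹' {k}).indicator fun t => sgn (x t),
    (measurable_sgn.comp (measurable_coe x)).indicator
      (measurable_cell ε x (measurableSet_singleton k)), fun t => by
      by_cases h : t ∈ cell ε x ⁻¹' {k}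
      · rw [indicator_of_mem h, abs_sgn]
      · rw [indicator_of_notMem h, abs_zero]
        exact zero_le_one⟩

theorem pairing_cellSign (ε : ℝ) (x : L0) (k : ℕ) (f : L1) :
    pairing (cellSign ε x k) f = ∫ t in cell ε x ⁻¹' {k}, f t * sgn (x t) ∂leb := by
  rw [pairing_apply, ← integral_indicator (measurable_cell ε x (measurableSet_singleton k))]
  congr 1 with t
  exact (indicator_mul_right (cell ε x ⁻¹' {k}) (fun t => f t) fun t => sgn (x t)).symm

theorem enorm_pairing_cellSign_le (ε : ℝ) (x : L0) (k : ℕ) (f : L1) :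
    ‖pairing (cellSign ε x k) f‖ₑ ≤ ∫⁻ t in cell ε x ⁻¹' {k}, ENNReal.ofReal |f t| ∂leb := by
  rw [pairing_cellSign]
  refine (enorm_integral_le_lintegral_enorm _).trans (lintegral_mono fun t => ?_)
  rw [Real.enorm_eq_ofReal_abs, abs_mul, abs_sgn, mul_one]

theorem integral_abs_cellSign (ε : ℝ) (x : L0) (k : ℕ) :
    ∫ t, |(cellSign ε x k).1 t| ∂leb = (leb (cell ε x ⁻¹' {k})).toReal := by
  have : ∀ t, |(cellSign ε x k).1 t| = (cell ε x ⁻¹' {k}).indicator 1 t := fun t => by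
    by_cases h : t ∈ cell ε x ⁻¹' {k}
    · rw [indicator_of_mem h]
      simp [cellSign, indicator_of_mem h, abs_sgn]
    · rw [indicator_of_notMem h]
      simp [cellSign, indicator_of_notMem h]
  simp only [this]
  rw [integral_indicator_one (measurable_cell ε x (measurableSet_singleton k))]
  rfl

theorem abs_pairing_cellSign_le (ε : ℝ) (x : L0) (k : ℕ) {f : L1} {l : ℝ}
    (hl : ∀ᵐ t ∂leb, |f t| ≤ l) :
    |pairing (cellSign ε x k) f| ≤ l * (leb (cell ε x ⁻¹' {k})).toReal := by
  rw [← integral_abs_cellSign, abs_le]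
  refine ⟨?_, pairing_le_of_bound hl _⟩
  have h := pairing_le_of_bound (f := -f) (l := l) ?_ (cellSign ε x k)
  · rw [map_neg] at h
    linarith
  · filter_upwards [hl, Lp.coeFn_neg f] with t h1 h2
    rw [h2, Pi.neg_apply, abs_neg]
    exact h1

/-- The average of `f · sgn x` over a level set of `|x|`. -/
def cellAvg (ε : ℝ) (x : L0) (f : L1) (k : ℕ) : ℝ :=
  (leb (cell ε x ⁻¹' {k})).toReal⁻¹ * pairing (cellSign ε x k) f

theorem enorm_cellAvg_mul_le (ε : ℝ) (x : L0) (f : L1) (k : ℕ) :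
    ‖cellAvg ε x f k‖ₑ * leb (cell ε x ⁻¹' {k}) ≤
      ∫⁻ t in cell ε x ⁻¹' {k}, ENNReal.ofReal |f t| ∂leb := by
  refine le_trans ?_ (enorm_pairing_cellSign_le ε x k f)
  by_cases h : leb (cell ε x ⁻¹' {k}) = 0
  · rw [h, mul_zero]
    exact bot_le
  · have hpos : 0 < (leb (cell ε x ⁻¹' {k})).toReal :=
      ENNReal.toReal_pos h (measure_ne_top _ _)
    rw [cellAvg, enorm_mul, mul_right_comm]
    refine mul_le_of_le_one_left bot_le ?_
    rw [enorm_inv hpos.ne', Real.enorm_of_nonneg hpos.le,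
      ENNReal.ofReal_toReal (measure_ne_top _ _), ENNReal.inv_mul_cancel h (measure_ne_top _ _)]

theorem abs_cellAvg_le (ε : ℝ) (x : L0) {f : L1} {l : ℝ} (hl : ∀ᵐ t ∂leb, |f t| ≤ l) (k : ℕ) :
    |cellAvg ε x f k| ≤ l := by
  have hl0 : 0 ≤ l := by
    obtain ⟨t, ht⟩ := hl.exists
    exact (abs_nonneg _).trans ht
  have h := abs_pairing_cellSign_le ε x k hl
  rw [cellAvg, abs_mul, abs_inv, abs_of_nonneg ENNReal.toReal_nonneg]
  rcases (ENNReal.toReal_nonneg (a := leb (cell ε x ⁻¹' {k}))).eq_or_lt with h0 | h0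
  · rw [← h0, inv_zero, zero_mul]
    exact hl0
  · rw [inv_mul_le_iff₀ h0, mul_comm]
    exact h

theorem leb_cell_congr {x z : L0} (h : law z = law x) (ε : ℝ) (k : ℕ) :
    leb (cell ε z ⁻¹' {k}) = leb (cell ε x ⁻¹' {k}) := by
  have hm : MeasurableSet {r : ℝ | ⌊r / ε⌋₊ = k} :=
    (Nat.measurable_floor.comp (measurable_id.div_const ε)) (measurableSet_singleton k)
  have hz := law_apply z hm
  rw [h, law_apply x hm] at hz
  exact hz.symm

/-- Averaging over the level sets of `|x|`, transported to the level sets of `|z|`. -/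
def transferFun (ε : ℝ) (x z : L0) (f : L1) : L0 :=
  AEEqFun.mk (fun t => sgn (z t) * cellAvg ε x f (cell ε z t))
    ((measurable_sgn.comp (measurable_coe z)).mul
      ((measurable_of_countable (cellAvg ε x f)).comp
        (measurable_cell ε z))).aestronglyMeasurable

theorem coe_transferFun (ε : ℝ) (x z : L0) (f : L1) :
    transferFun ε x z f =ᵐ[leb] fun t => sgn (z t) * cellAvg ε x f (cell ε z t) :=
  AEEqFun.coeFn_mk _ _

theorem lintegral_transferFun_le {x z : L0} (h : law z = law x) (ε : ℝ) (f : L1) :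
    ∫⁻ t, ENNReal.ofReal |transferFun ε x z f t| ∂leb ≤ ∫⁻ t, ENNReal.ofReal |f t| ∂leb := by
  have h1 : ∫⁻ t, ENNReal.ofReal |transferFun ε x z f t| ∂leb =
      ∫⁻ t, ‖cellAvg ε x f (cell ε z t)‖ₑ ∂leb := by
    refine lintegral_congr_ae ?_
    filter_upwards [coe_transferFun ε x z f] with t ht
    rw [ht, abs_mul, abs_sgn, one_mul, Real.enorm_eq_ofReal_abs]
  rw [h1, lintegral_comp_nat (measurable_cell ε z) fun k => ‖cellAvg ε x f k‖ₑ,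
    ← tsum_lintegral_fiber (measurable_cell ε x)]
  refine ENNReal.tsum_le_tsum fun k => ?_
  rw [leb_cell_congr h]
  exact enorm_cellAvg_mul_le ε x f k

/-- The operator of `transferFun`. -/
def transfer (ε : ℝ) {x z : L0} (h : law z = law x) : L1 →ₗ[ℝ] L1 where
  toFun f := ⟨transferFun ε x z f,
    mem_L1_iff.2 ((lintegral_transferFun_le h ε f).trans_lt (mem_L1_iff.1 f.2))⟩
  map_add' f g := by
    refine Subtype.ext (AEEqFun.ext ?_)
    filter_upwards [coe_transferFun ε x z f, coe_transferFun ε x z g,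
      coe_transferFun ε x z (f + g),
      AEEqFun.coeFn_add (transferFun ε x z f) (transferFun ε x z g)] with t h1 h2 h3 h4
    rw [AddSubgroup.coe_add, h4, Pi.add_apply, h1, h2, h3]
    simp only [cellAvg, map_add]
    ring
  map_smul' c f := by
    refine Subtype.ext (AEEqFun.ext ?_)
    filter_upwards [coe_transferFun ε x z f, coe_transferFun ε x z (c • f),
      AEEqFun.coeFn_smul c (transferFun ε x z f)] with t h1 h2 h3
    refine h2.trans (Eq.trans ?_ h3.symm)
    rw [Pi.smul_apply, h1]
    simp only [cellAvg, map_smul, smul_eq_mul]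
    ring

theorem transfer_mem (ε : ℝ) {x z : L0} (h : law z = law x) :
    transfer ε h ∈ absoluteContractions := by
  refine ⟨fun f => ?_, fun f => ?_⟩
  · rw [← enorm_le_iff_norm_le, ← lintegral_abs_coe, ← lintegral_abs_coe]
    exact lintegral_transferFun_le h ε f
  · by_cases htop : eLpNorm f ∞ leb = ∞
    · rw [htop]
      exact le_top
    · have hl : ∀ᵐ t ∂leb, |f t| ≤ (eLpNorm f ∞ leb).toReal := by
        rw [← eLpNorm_top_le_iff ENNReal.toReal_nonneg, ENNReal.ofReal_toReal htop]
      rw [← ENNReal.ofReal_toReal htop, eLpNorm_top_le_iff ENNReal.toReal_nonneg]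
      filter_upwards [coe_transferFun ε x z f] with t ht
      refine (congrArg abs ht).trans_le ?_
      rw [abs_mul, abs_sgn, one_mul]
      exact abs_cellAvg_le ε x hl _

theorem pairing_self_bounds {ε : ℝ} (hε : 0 < ε) (f : L1) (k : ℕ) :
    k * ε * (leb (cell ε f ⁻¹' {k})).toReal ≤ pairing (cellSign ε f k) f ∧
      pairing (cellSign ε f k) f ≤ (k * ε + ε) * (leb (cell ε f ⁻¹' {k})).toReal := by
  have hS : MeasurableSet (cell ε f ⁻¹' {k}) := measurable_cell ε f (measurableSet_singleton k)
  rw [pairing_cellSign]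
  simp only [mul_sgn]
  have hconst : ∀ c : ℝ, ∫ t in cell ε f ⁻¹' {k}, c ∂leb =
      c * (leb (cell ε f ⁻¹' {k})).toReal := fun c => by
    rw [setIntegral_const, smul_eq_mul, mul_comm]
    rfl
  rw [← hconst, ← hconst]
  constructor
  · refine setIntegral_mono_on (integrable_const _) (integrable_coe f).abs.integrableOn hS
      fun t ht => ?_
    have := (cell_bounds hε f t).1
    rwa [show cell ε f t = k from ht] at this
  · refine setIntegral_mono_on (integrable_coe f).abs.integrableOn (integrable_const _) hS
      fun t ht => ?_
    have := (cell_bounds hε f t).2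
    rw [show cell ε f t = k from ht] at this
    exact this.le

/-- Corresponding cells of x and z have equal measure. Averaging f · sgn x over the cells of x and
placing the averages, times sgn z, on the cells of z is an absolute contraction that sends x to
within ε of z uniformly. Closedness of the orbit finishes the argument. -/
theorem mem_orbit_of_law_eq {x z : L0} (hx : x ∈ Lp ℝ 1 leb) (h : law z = law x) :
    z ∈ orbit x := by
  have hz : z ∈ Lp ℝ 1 leb := by
    rw [mem_L1_iff] at hx ⊢
    rwa [← lintegral_law z ENNReal.measurable_ofReal, h,
      lintegral_law x ENNReal.measurable_ofReal]
  refine mem_orbit_of_approx hz fun ε' hε' => ?_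
  obtain ⟨ε, hε0, hεε'⟩ := ENNReal.lt_iff_exists_real_btwn.1 hε'
  have hε : 0 < ε := ENNReal.ofReal_pos.1 hεε'.1
  let f : L1 := ⟨x, hx⟩
  refine ⟨transferFun ε x z f, ⟨f, rfl, transfer ε h, transfer_mem ε h, rfl⟩,
    lt_of_le_of_lt ?_ hεε'.2⟩
  have hbd : ∀ᵐ t ∂leb, ENNReal.ofReal |z t - transferFun ε x z f t| ≤ ENNReal.ofReal ε := by
    filter_upwards [coe_transferFun ε x z f, ae_fiber_ne_zero (measurable_cell ε z)] with t ht h0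
    refine ENNReal.ofReal_le_ofReal ?_
    set k := cell ε z t with hk
    rw [leb_cell_congr h] at h0
    have hpos : 0 < (leb (cell ε x ⁻¹' {k})).toReal := ENNReal.toReal_pos h0 (measure_ne_top _ _)
    obtain ⟨h1, h2⟩ := pairing_self_bounds hε f k
    obtain ⟨h3, h4⟩ := cell_bounds hε z t
    have e : cellAvg ε x f k = pairing (cellSign ε f k) f / (leb (cell ε x ⁻¹' {k})).toReal := by
      rw [div_eq_inv_mul]
      rfl
    have h5 : k * ε ≤ cellAvg ε x f k := by
      rw [e, le_div_iff₀ hpos]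
      exact h1
    have h6 : cellAvg ε x f k ≤ k * ε + ε := by
      rw [e, div_le_iff₀ hpos]
      exact h2
    rw [← hk] at h3 h4
    have e2 : z t - sgn (z t) * cellAvg ε x f k = sgn (z t) * (|z t| - cellAvg ε x f k) := by
      rw [mul_sub, sgn_mul_abs]
    rw [ht, e2, abs_mul, abs_sgn, one_mul, abs_le]
    constructor <;> linarith
  refine (lintegral_mono_ae hbd).trans ?_
  simp

/-! ### Equimeasurable functions are extreme points of the orbit -/

/-- A level q just above a|u| + b|v| annihilates the left side, so |u| and |v| do not exceed their
own weighted mean and hence coincide. Level 0 then gives |z| = |v|, which rules out opposite signs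
unless both vanish. -/
theorem eq_of_forall_level {a b u v z : ℝ} (ha : 0 < a) (hb : 0 < b) (hab : a + b = 1)
    (hz : z = a * u + b * v)
    (h : ∀ q : ℚ, ENNReal.ofReal (|z| - |(q : ℝ)|) = ENNReal.ofReal a *
      ENNReal.ofReal (|u| - |(q : ℝ)|) + ENNReal.ofReal b * ENNReal.ofReal (|v| - |(q : ℝ)|)) :
    u = v := by
  have habs : |z| ≤ a * |u| + b * |v| := by
    rw [hz]
    refine (abs_add_le _ _).trans ?_
    rw [abs_mul, abs_mul, abs_of_pos ha, abs_of_pos hb]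
  have key : ∀ q : ℚ, a * |u| + b * |v| < q → |u| ≤ q ∧ |v| ≤ q := by
    intro q hq
    have h0 : 0 ≤ a * |u| + b * |v| := by positivity
    have hq0 : |(q : ℝ)| = q := abs_of_nonneg (h0.trans hq.le)
    have := h q
    rw [hq0, ENNReal.ofReal_of_nonpos (by linarith), eq_comm, add_eq_zero, mul_eq_zero,
      mul_eq_zero, ENNReal.ofReal_eq_zero, ENNReal.ofReal_eq_zero, ENNReal.ofReal_eq_zero,
      ENNReal.ofReal_eq_zero] at this
    constructor
    · rcases this.1 with h | h <;> linarith
    · rcases this.2 with h | h <;> linarith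
  have hle : |u| ≤ a * |u| + b * |v| ∧ |v| ≤ a * |u| + b * |v| := by
    constructor
    · by_contra hlt
      obtain ⟨q, h1, h2⟩ := exists_rat_btwn (not_le.1 hlt)
      linarith [(key q h1).1]
    · by_contra hlt
      obtain ⟨q, h1, h2⟩ := exists_rat_btwn (not_le.1 hlt)
      linarith [(key q h1).2]
  have huv : |u| = |v| := by
    have hb' : b = 1 - a := by linarith
    subst hb'
    refine le_antisymm ?_ ?_
    · nlinarith [hle.1]
    · nlinarith [hle.2]
  rcases abs_eq_abs.1 huv with h1 | h1
  · exact h1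
  · have h0 := h 0
    rw [Rat.cast_zero, abs_zero, sub_zero, sub_zero, sub_zero, ← ENNReal.ofReal_mul ha.le,
      ← ENNReal.ofReal_mul hb.le, ← ENNReal.ofReal_add (by positivity) (by positivity),
      huv, ← add_mul, hab, one_mul, ENNReal.ofReal_eq_ofReal_iff (abs_nonneg _) (abs_nonneg _)]
      at h0
    have : z = (b - a) * v := by rw [hz, h1]; ring
    rw [this, abs_mul] at h0
    have hlt : |b - a| < 1 := by rw [abs_lt]; constructor <;> linarith
    have hv : |v| = 0 := by nlinarith [abs_nonneg v]
    rw [abs_eq_zero] at hv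
    rw [h1, hv, neg_zero]

/-- The convexity inequality for (|·| - l)₊ holds pointwise. After integration its right side is at
most the excess of x, which is that of z; these integrals are finite, so equality holds almost
everywhere, simultaneously for all rational levels. -/
theorem mem_extremePoints_orbit {x z : L0} (hx : x ∈ Lp ℝ 1 leb) (h : law z = law x) :
    z ∈ extremePoints ℝ (orbit x) := by
  refine ⟨mem_orbit_of_law_eq hx h, fun u hu v hv hz => ?_⟩
  obtain ⟨a, b, ha, hb, hab, hz⟩ := hz
  have hcoe : ∀ᵐ t ∂leb, z t = a * u t + b * v t := by
    rw [← hz]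
    filter_upwards [AEEqFun.coeFn_add (a • u) (b • v), AEEqFun.coeFn_smul a u,
      AEEqFun.coeFn_smul b v] with t h1 h2 h3
    rw [h1, Pi.add_apply, h2, h3, Pi.smul_apply, Pi.smul_apply, smul_eq_mul, smul_eq_mul]
  have hlev : ∀ q : ℚ, ∀ᵐ t ∂leb, ENNReal.ofReal (|z t| - |(q : ℝ)|) = ENNReal.ofReal a *
      ENNReal.ofReal (|u t| - |(q : ℝ)|) +
        ENNReal.ofReal b * ENNReal.ofReal (|v t| - |(q : ℝ)|) := by
    intro q
    have hm : ∀ w : L0, Measurable fun t => ENNReal.ofReal (|w t| - |(q : ℝ)|) := fun w =>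
      (measurable_ofReal_sub _).comp (measurable_abs_coe w)
    have hzx : ∫⁻ t, ENNReal.ofReal (|z t| - |(q : ℝ)|) ∂leb =
        ∫⁻ t, ENNReal.ofReal (|x t| - |(q : ℝ)|) ∂leb := by
      rw [← lintegral_law z (measurable_ofReal_sub _), h, lintegral_law x (measurable_ofReal_sub _)]
    refine ae_eq_of_ae_le_of_lintegral_le ?_ ?_
      (((hm u).const_mul _).add ((hm v).const_mul _)).aemeasurable ?_
    · filter_upwards [hcoe] with t ht
      rw [← ENNReal.ofReal_mul ha.le, ← ENNReal.ofReal_mul hb.le]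
      refine le_trans (ENNReal.ofReal_le_ofReal ?_) ENNReal.ofReal_add_le
      have : |z t| ≤ a * |u t| + b * |v t| := by
        rw [ht]
        refine (abs_add_le _ _).trans ?_
        rw [abs_mul, abs_mul, abs_of_pos ha, abs_of_pos hb]
      have e : a * (|u t| - |(q : ℝ)|) + b * (|v t| - |(q : ℝ)|) =
          a * |u t| + b * |v t| - (a + b) * |(q : ℝ)| := by ring
      rw [e, hab, one_mul]
      linarith
    · rw [hzx]
      refine ((lintegral_mono fun t => ENNReal.ofReal_le_ofReal ?_).trans_lt
        (mem_L1_iff.1 hx)).ne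
      linarith [abs_nonneg (q : ℝ)]
    · rw [lintegral_add_left ((hm u).const_mul _), lintegral_const_mul _ (hm u),
        lintegral_const_mul _ (hm v), hzx]
      calc _ ≤ ENNReal.ofReal a * ∫⁻ t, ENNReal.ofReal (|x t| - |(q : ℝ)|) ∂leb +
            ENNReal.ofReal b * ∫⁻ t, ENNReal.ofReal (|x t| - |(q : ℝ)|) ∂leb := by
            refine add_le_add (mul_le_mul_right ?_ _) (mul_le_mul_right ?_ _)
            · exact lintegral_sub_le_of_mem_orbit hu (abs_nonneg _)
            · exact lintegral_sub_le_of_mem_orbit hv (abs_nonneg _)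
        _ = _ := by rw [← add_mul, ← ENNReal.ofReal_add ha.le hb.le, hab, ENNReal.ofReal_one,
            one_mul]
  refine AEEqFun.ext ?_
  filter_upwards [hcoe, ae_all_iff.2 hlev] with t h1 h2
  have huv := eq_of_forall_level ha hb hab h1 h2
  rw [h1, ← huv, ← add_mul, hab, one_mul]

/-! ### Adjoints of absolute contractions -/

theorem integrable_unitFun (g : UnitFun) : Integrable g.1 leb := by
  simpa using integrable_mul_of_bound (integrable_const (1 : ℝ)) g.2.1 g.2.2

/-- A function bounded by one, as an element of `L₁`. -/
def UnitFun.toL1 (g : UnitFun) : L1 := (integrable_unitFun g).toL1 g.1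

theorem UnitFun.coe_toL1 (g : UnitFun) : g.toL1 =ᵐ[leb] g.1 := (integrable_unitFun g).coeFn_toL1

theorem pairing_toL1_comm (g h : UnitFun) : pairing g h.toL1 = pairing h g.toL1 := by
  rw [pairing_apply, pairing_apply]
  refine integral_congr_ae ?_
  filter_upwards [g.coe_toL1, h.coe_toL1] with t h1 h2
  rw [h1, h2, mul_comm]

theorem UnitFun.norm_toL1 (g : UnitFun) : ‖g.toL1‖ = ∫ t, |g.1 t| ∂leb := by
  rw [norm_eq_integral_abs]
  refine integral_congr_ae ?_
  filter_upwards [g.coe_toL1] with t ht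
  rw [ht]

/-- Functionals of norm at most one on `L₁` are represented by functions bounded by one. -/
theorem exists_pairing_eq (Λ : L1 →ₗ[ℝ] ℝ) (hΛ : ∀ f, |Λ f| ≤ ‖f‖) :
    ∃ p : UnitFun, ∀ f, Λ f = pairing p f := by
  have hmem : ∀ φ : Lp ℝ 2 leb, MemLp φ 1 leb := fun φ => (Lp.memLp φ).mono_exponent (by norm_num)
  have hcont : ∃ Λ₂ : StrongDual ℝ (Lp ℝ 2 leb), ∀ φ, Λ₂ φ = Λ ((hmem φ).toLp φ) := by
    refine ⟨LinearMap.mkContinuous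
      { toFun := fun φ => Λ ((hmem φ).toLp φ)
        map_add' := fun φ ψ => ?_
        map_smul' := fun c φ => ?_ } 1 fun φ => ?_, fun φ => rfl⟩
    · rw [← map_add]
      congr 1
      refine Lp.ext ?_
      filter_upwards [(hmem (φ + ψ)).coeFn_toLp, (hmem φ).coeFn_toLp, (hmem ψ).coeFn_toLp,
        Lp.coeFn_add φ ψ, Lp.coeFn_add ((hmem φ).toLp φ) ((hmem ψ).toLp ψ)] with t h1 h2 h3 h4 h5
      rw [h1, h4, h5, Pi.add_apply, Pi.add_apply, h2, h3]
    · rw [RingHom.id_apply, ← map_smul]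
      congr 1
      refine Lp.ext ?_
      filter_upwards [(hmem (c • φ)).coeFn_toLp, (hmem φ).coeFn_toLp,
        Lp.coeFn_smul c φ, Lp.coeFn_smul c ((hmem φ).toLp φ)] with t h1 h2 h4 h5
      rw [h1, h4, h5, Pi.smul_apply, Pi.smul_apply, h2]
    · rw [one_mul]
      refine (hΛ _).trans ?_
      rw [Lp.norm_toLp, Lp.norm_def]
      refine ENNReal.toReal_mono (Lp.eLpNorm_ne_top φ) ?_
      exact eLpNorm_le_eLpNorm_of_exponent_le (by norm_num) (Lp.aestronglyMeasurable φ)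
  obtain ⟨Λ₂, hΛ₂⟩ := hcont
  -- The density comes from the Riesz representation on L₂. The representation is then checked on
  -- bounded functions and extended to L₁ through truncations.
  let h : Lp ℝ 2 leb := (InnerProductSpace.toDual ℝ _).symm Λ₂
  let p₀ : L1 := (hmem h).toLp h
  have hrep : ∀ φ : Lp ℝ 2 leb, Λ ((hmem φ).toLp φ) = ∫ t, φ t * p₀ t ∂leb := by
    intro φ
    have : InnerProductSpace.toDual ℝ _ h φ = Λ₂ φ := by simp [h]
    rw [← hΛ₂, ← this, InnerProductSpace.toDual_apply_apply, L2.inner_def]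
    refine integral_congr_ae ?_
    filter_upwards [(hmem h).coeFn_toLp] with t ht
    rw [show p₀ t = h t from ht]
    simp
  have hbdd : ∀ (u : L0) (l : ℝ), (∀ᵐ t ∂leb, |u t| ≤ l) → ∀ f : L1, (f : L0) = u →
      Λ f = ∫ t, u t * p₀ t ∂leb := by
    rintro u l hl f rfl
    have hm : MemLp f 2 leb :=
      MemLp.of_bound (measurable_coe (f : L0)).aestronglyMeasurable l hl
    have e : (hmem (hm.toLp f)).toLp (hm.toLp f) = f := by
      refine Lp.ext ?_
      filter_upwards [(hmem (hm.toLp f)).coeFn_toLp, hm.coeFn_toLp] with t h1 h2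
      rw [h1, h2]
    have := hrep (hm.toLp f)
    rw [e] at this
    rw [this]
    refine integral_congr_ae ?_
    filter_upwards [hm.coeFn_toLp] with t h2
    rw [h2]
  have hp₀ : ∀ᵐ t ∂leb, |p₀ t| ≤ 1 := by
    refine bound_of_pairing_le fun g => ?_
    have h1 := hbdd g.toL1 1 (by
      filter_upwards [g.coe_toL1] with t ht
      rw [ht]
      exact g.2.2 t) g.toL1 rfl
    have h2 : pairing g p₀ = Λ g.toL1 := by
      rw [h1, pairing_apply]
      refine integral_congr_ae ?_
      filter_upwards [g.coe_toL1] with t ht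
      rw [ht, mul_comm]
    rw [h2, one_mul, ← g.norm_toL1]
    exact (le_abs_self _).trans (hΛ _)
  -- Truncation changes p₀ only on a null set and makes the bound by 1 hold everywhere.
  let p : UnitFun := ⟨fun t => truncate 1 (p₀ t),
    (measurable_truncate 1).comp (measurable_coe (p₀ : L0)),
    fun t => abs_truncate_le zero_le_one _⟩
  refine ⟨p, fun f => ?_⟩
  have hpp : ∀ᵐ t ∂leb, p.1 t = p₀ t := by
    filter_upwards [hp₀] with t ht
    obtain ⟨h1, h2⟩ := abs_le.1 ht
    change max (-1) (min (p₀ t) 1) = p₀ t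
    rw [min_eq_left h2, max_eq_right h1]
  have hn : ∀ n : ℕ, Λ (truncL1 n n.cast_nonneg f) = pairing p (truncL1 n n.cast_nonneg f) := by
    intro n
    rw [hbdd _ n (truncL0_bound n.cast_nonneg f) _ rfl, pairing_apply]
    refine integral_congr_ae ?_
    filter_upwards [hpp] with t ht
    rw [ht]
    rfl
  let Λ' : L1 →L[ℝ] ℝ := Λ.mkContinuous 1 fun f => by rw [one_mul]; exact hΛ f
  have h1 := (Λ'.continuous.tendsto f).comp (tendsto_truncL1 f)
  have h2 := ((pairing p).continuous.tendsto f).comp (tendsto_truncL1 f)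
  exact tendsto_nhds_unique h1 (h2.congr fun n => (hn n).symm)

theorem exists_adjoint {T : L1 →ₗ[ℝ] L1} (hT : T ∈ absoluteContractions) (g : UnitFun) :
    ∃ p : UnitFun, ∀ f, pairing g (T f) = pairing p f :=
  exists_pairing_eq ((pairing g).toLinearMap.comp T) fun f =>
    (abs_pairing_le g (T f)).trans (hT.1 f)

theorem contraction_bound {T : L1 →ₗ[ℝ] L1} (hT : T ∈ absoluteContractions) {f : L1} {l : ℝ}
    (hl0 : 0 ≤ l) (hl : ∀ᵐ t ∂leb, |f t| ≤ l) : ∀ᵐ t ∂leb, |T f t| ≤ l :=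
  (eLpNorm_top_le_iff hl0).1 ((hT.2 f).trans ((eLpNorm_top_le_iff hl0).2 hl))

/-! ### Decomposition of an absolute contraction over the level sets of an image -/

/-- Indexing sign patterns by finite sets keeps them countable, so almost-everywhere bounds can be
imposed on all of them at once. -/
theorem sum_abs_le_of_signs {n : ℕ} {p : ℕ → ℝ}
    (h : ∀ s : Finset ℕ, |∑ k ∈ Finset.range n, (if k ∈ s then 1 else -1) * p k| ≤ 1) :
    ∑ k ∈ Finset.range n, |p k| ≤ 1 := by
  classical
  refine le_trans (le_of_eq (Finset.sum_congr rfl fun k hk => ?_))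
    ((le_abs_self _).trans (h ((Finset.range n).filter fun k => 0 ≤ p k)))
  by_cases hk0 : 0 ≤ p k
  · rw [if_pos (Finset.mem_filter.2 ⟨hk, hk0⟩), one_mul, abs_of_nonneg hk0]
  · have hk' : k ∉ (Finset.range n).filter fun k => 0 ≤ p k := fun h =>
      hk0 (Finset.mem_filter.1 h).2
    rw [if_neg hk', neg_one_mul, abs_of_neg (not_le.1 hk0)]

/-- Signed sums of the functions `cellSign`. -/
def signedCells (ε : ℝ) (y : L0) (n : ℕ) (s : Finset ℕ) : UnitFun :=
  ⟨fun t => ∑ k ∈ Finset.range n, (if k ∈ s then 1 else -1) * (cellSign ε y k).1 t,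
    Finset.measurable_fun_sum _ fun k _ => (cellSign ε y k).2.1.const_mul _, fun t => by
      have hz : ∀ k ≠ cell ε y t, (cellSign ε y k).1 t = 0 := fun k hk =>
        indicator_of_notMem (s := cell ε y ⁻¹' {k}) (f := fun t => sgn (y t))
          (fun h => hk (Eq.symm h))
      beta_reduce
      by_cases hk : cell ε y t ∈ Finset.range n
      · rw [Finset.sum_eq_single_of_mem _ hk fun k _ hk => by rw [hz k hk, mul_zero], abs_mul]
        refine mul_le_one₀ ?_ (abs_nonneg _) ((cellSign ε y _).2.2 t)
        split_ifs <;> simp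
      · rw [Finset.sum_eq_zero fun k hk' => ?_, abs_zero]
        · exact zero_le_one
        · rw [hz k fun h => hk (h ▸ hk'), mul_zero]⟩

theorem pairing_signedCells (ε : ℝ) (y : L0) (n : ℕ) (s : Finset ℕ) (f : L1) :
    pairing (signedCells ε y n s) f =
      ∑ k ∈ Finset.range n, (if k ∈ s then 1 else -1) * pairing (cellSign ε y k) f := by
  simp only [pairing_apply]
  simp only [← integral_const_mul]
  rw [← integral_finsetSum _ fun k _ => (integrable_mul_of_bound (integrable_coe f)
    (cellSign ε y k).2.1 (cellSign ε y k).2.2).const_mul _]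
  refine integral_congr_ae (ae_of_all _ fun t => ?_)
  simp only [signedCells, Finset.mul_sum]
  exact Finset.sum_congr rfl fun k _ => by ring

section Adjoint

variable {T : L1 →ₗ[ℝ] L1} {ε : ℝ} {y : L0} {p : ℕ → UnitFun}

/-- A signed sum of the cell functions is bounded by 1, because the cells are disjoint. Its image
under the adjoint is the same signed sum of the p_k and is again bounded by 1; the signs are then
varied. -/
theorem ae_tsum_adjoint_le (hT : T ∈ absoluteContractions)
    (hp : ∀ k f, pairing (cellSign ε y k) (T f) = pairing (p k) f) :
    ∀ᵐ t ∂leb, ∑' k, ‖(p k).1 t‖ₑ ≤ 1 := by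
  have h1 : ∀ (n : ℕ) (s : Finset ℕ), ∀ᵐ t ∂leb,
      |∑ k ∈ Finset.range n, (if k ∈ s then 1 else -1) * (p k).1 t| ≤ 1 := by
    intro n s
    obtain ⟨P, hP⟩ := exists_adjoint hT (signedCells ε y n s)
    let h : L1 := ∑ k ∈ Finset.range n, (if k ∈ s then (1 : ℝ) else -1) • (p k).toL1
    have e : P.toL1 = h := by
      refine eq_of_pairing_eq fun g => ?_
      rw [pairing_toL1_comm, ← hP, pairing_signedCells, map_sum]
      refine Finset.sum_congr rfl fun k _ => ?_
      rw [hp, map_smul, smul_eq_mul, pairing_toL1_comm]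
    have hcoe : h =ᵐ[leb] fun t => ∑ k ∈ Finset.range n, (if k ∈ s then 1 else -1) * (p k).1 t := by
      have h2 : ∀ m : ℕ, (∑ k ∈ Finset.range m, (if k ∈ s then (1 : ℝ) else -1) • (p k).toL1 : L1)
          =ᵐ[leb] fun t => ∑ k ∈ Finset.range m, (if k ∈ s then 1 else -1) * (p k).1 t := by
        intro m
        induction m with
        | zero =>
          simp only [Finset.range_zero, Finset.sum_empty]
          exact Lp.coeFn_zero ℝ 1 leb
        | succ m ih =>
          simp only [Finset.sum_range_succ]
          filter_upwards [ih, Lp.coeFn_add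
            (∑ k ∈ Finset.range m, (if k ∈ s then (1 : ℝ) else -1) • (p k).toL1)
            ((if m ∈ s then (1 : ℝ) else -1) • (p m).toL1),
            Lp.coeFn_smul (if m ∈ s then (1 : ℝ) else -1) (p m).toL1,
            (p m).coe_toL1] with t h1 h2 h3 h4
          rw [h2, Pi.add_apply, h1, h3, Pi.smul_apply, h4, smul_eq_mul]
      exact h2 n
    have hPc := P.coe_toL1
    rw [e] at hPc
    filter_upwards [hPc, hcoe] with t h1 h2
    rw [← h2, h1]
    exact P.2.2 t
  have h2 : ∀ᵐ t ∂leb, ∀ (n : ℕ) (s : Finset ℕ),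
      |∑ k ∈ Finset.range n, (if k ∈ s then 1 else -1) * (p k).1 t| ≤ 1 :=
    ae_all_iff.2 fun n => ae_all_iff.2 fun s => h1 n s
  filter_upwards [h2] with t ht
  refine ENNReal.tsum_le_of_sum_range_le fun n => ?_
  have h3 := sum_abs_le_of_signs (ht n)
  simp only [Real.enorm_eq_ofReal_abs]
  rw [← ENNReal.ofReal_sum_of_nonneg fun _ _ => abs_nonneg _]
  exact ENNReal.ofReal_le_one.2 h3

theorem lintegral_unitFun (p : UnitFun) :
    ∫⁻ t, ‖p.1 t‖ₑ ∂leb = ENNReal.ofReal (∫ t, |p.1 t| ∂leb) := by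
  rw [ofReal_integral_eq_lintegral_ofReal (integrable_unitFun p).abs
    (ae_of_all _ fun _ => abs_nonneg _)]
  simp only [Real.enorm_eq_ofReal_abs]

/-- This is where the L_∞ contraction enters: T(sgn p_k) is bounded by 1, so its integral against
the k-th cell function is at most the measure of the cell. -/
theorem lintegral_adjoint_le (hT : T ∈ absoluteContractions)
    (hp : ∀ k f, pairing (cellSign ε y k) (T f) = pairing (p k) f) (k : ℕ) :
    ∫⁻ t, ‖(p k).1 t‖ₑ ∂leb ≤ leb (cell ε y ⁻¹' {k}) := by
  let g : UnitFun := ⟨fun t => sgn ((p k).1 t), measurable_sgn.comp (p k).2.1,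
    fun t => (abs_sgn _).le⟩
  have h1 : pairing (p k) g.toL1 = ∫ t, |(p k).1 t| ∂leb := by
    rw [pairing_apply]
    refine integral_congr_ae ?_
    filter_upwards [g.coe_toL1] with t ht
    rw [ht, mul_comm]
    exact mul_sgn _
  have h2 : pairing (p k) g.toL1 ≤ 1 * (leb (cell ε y ⁻¹' {k})).toReal := by
    rw [← hp, ← integral_abs_cellSign]
    refine pairing_le_of_bound (contraction_bound hT zero_le_one ?_) _
    filter_upwards [g.coe_toL1] with t ht
    rw [ht]
    exact g.2.2 t
  rw [h1, one_mul] at h2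
  rw [lintegral_unitFun]
  exact ENNReal.ofReal_le_of_le_toReal h2

/-- The pairing of y with its own sign on the k-th cell is the integral of |y| there, at least kε
times the measure of the cell; the adjoint moves this pairing to f. -/
theorem le_lintegral_adjoint_mul (hε : 0 < ε) {f : L1} (hy : y = T f)
    (hp : ∀ k f, pairing (cellSign ε y k) (T f) = pairing (p k) f) (k : ℕ) :
    ENNReal.ofReal (k * ε) * leb (cell ε y ⁻¹' {k}) ≤
      ∫⁻ t, ‖(p k).1 t‖ₑ * ENNReal.ofReal |f t| ∂leb := by
  subst hy
  have h1 := (pairing_self_bounds hε (T f) k).1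
  rw [hp] at h1
  have hk : (0 : ℝ) ≤ k * ε := by positivity
  calc ENNReal.ofReal (k * ε) * leb (cell ε (T f) ⁻¹' {k})
      = ENNReal.ofReal (k * ε * (leb (cell ε (T f) ⁻¹' {k})).toReal) := by
        rw [ENNReal.ofReal_mul hk, ENNReal.ofReal_toReal (measure_ne_top _ _)]
    _ ≤ ENNReal.ofReal (pairing (p k) f) := ENNReal.ofReal_le_ofReal h1
    _ ≤ ‖pairing (p k) f‖ₑ := Real.ofReal_le_enorm _
    _ ≤ ∫⁻ t, ‖f t * (p k).1 t‖ₑ ∂leb := enorm_integral_le_lintegral_enorm _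
    _ = _ := by
        refine lintegral_congr fun t => ?_
        rw [enorm_mul, mul_comm, Real.enorm_eq_ofReal_abs (f t)]

end Adjoint

/-- Completion of subprobability kernels with prescribed marginals to probability kernels. -/
theorem exists_completion {p : ℕ → ℝ → ℝ≥0∞} {a : ℕ → ℝ≥0∞} (hp : ∀ k, Measurable (p k))
    (hsum : ∀ᵐ t ∂leb, ∑' k, p k t ≤ 1) (hint : ∀ k, ∫⁻ t, p k t ∂leb ≤ a k)
    (ha : ∑' k, a k = 1) :
    ∃ q : ℕ → ℝ → ℝ≥0∞, (∀ k, Measurable (q k)) ∧ (∀ k t, p k t ≤ q k t) ∧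
      (∀ᵐ t ∂leb, ∑' k, q k t = 1) ∧ ∀ k, ∫⁻ t, q k t ∂leb = a k := by
  -- The deficit r(t) of the sums over k and the deficits b_k of the integrals have the same total
  -- R. Adding the product b_k r(t)/R repairs both marginals; if R = 0 nothing is missing.
  let r : ℝ → ℝ≥0∞ := fun t => 1 - ∑' k, p k t
  have hrm : Measurable r := measurable_const.sub (Measurable.tsum hp)
  let R : ℝ≥0∞ := ∫⁻ t, r t ∂leb
  let b : ℕ → ℝ≥0∞ := fun k => a k - ∫⁻ t, p k t ∂leb
  have hpr : ∀ᵐ t ∂leb, (∑' k, p k t) + r t = 1 := by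
    filter_upwards [hsum] with t ht
    exact add_tsub_cancel_of_le ht
  have hPR : (∑' k, ∫⁻ t, p k t ∂leb) + R = 1 := by
    rw [← lintegral_tsum fun k => (hp k).aemeasurable,
      ← lintegral_add_left (Measurable.tsum hp), lintegral_congr_ae hpr]
    simp
  have hPb : (∑' k, ∫⁻ t, p k t ∂leb) + ∑' k, b k = 1 := by
    rw [← ENNReal.tsum_add, ← ha]
    exact tsum_congr fun k => add_tsub_cancel_of_le (hint k)
  have hPtop : (∑' k, ∫⁻ t, p k t ∂leb) ≠ ∞ :=
    ne_top_of_le_ne_top ENNReal.one_ne_top (hPb ▸ le_self_add)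
  have hRb : ∑' k, b k = R := (ENNReal.add_right_inj hPtop).1 (hPb.trans hPR.symm)
  have hRtop : R ≠ ∞ := ne_top_of_le_ne_top ENNReal.one_ne_top (hPR ▸ le_add_self)
  refine ⟨fun k t => p k t + b k / R * r t, fun k => (hp k).add (hrm.const_mul _),
    fun k t => le_self_add, ?_, fun k => ?_⟩
  · by_cases hR : R = 0
    · have hr0 : r =ᵐ[leb] 0 := (lintegral_eq_zero_iff hrm).1 hR
      filter_upwards [hpr, hr0] with t h1 h2
      rw [h2] at h1
      simpa [h2] using h1
    · filter_upwards [hpr] with t ht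
      rw [ENNReal.tsum_add, ENNReal.tsum_mul_right]
      simp only [div_eq_mul_inv]
      rw [ENNReal.tsum_mul_right, hRb, ENNReal.mul_inv_cancel hR hRtop, one_mul, ht]
  · rw [lintegral_add_left (hp k), lintegral_const_mul _ hrm]
    change _ + b k / R * R = _
    by_cases hR : R = 0
    · have hb : b k = 0 := by
        rw [hR, ENNReal.tsum_eq_zero] at hRb
        exact hRb k
      rw [hR, mul_zero, add_zero]
      exact le_antisymm (hint k) (tsub_eq_zero_iff_le.1 hb)
    · rw [ENNReal.div_mul_cancel hR hRtop]
      exact add_tsub_cancel_of_le (hint k)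

/-- The image `y` of `x` under an absolute contraction is controlled by probability measures on
the level sets of `y` whose mixture is the distribution of `|x|`. -/
theorem exists_level_laws {x y : L0} (hy : y ∈ orbit x) {ε : ℝ} (hε : 0 < ε) :
    ∃ ν : ℕ → Measure ℝ, (∀ k, IsProbabilityMeasure (ν k)) ∧ (∀ k, ν k (Iio 0) = 0) ∧
      (∀ S, MeasurableSet S → ∑' k, leb (cell ε y ⁻¹' {k}) * ν k S = law x S) ∧
      ∀ k, leb (cell ε y ⁻¹' {k}) ≠ 0 →
        ENNReal.ofReal (k * ε) ≤ ∫⁻ s, ENNReal.ofReal s ∂(ν k) := by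
  classical
  obtain ⟨f, rfl, T, hT, hTy⟩ := hy
  set a : ℕ → ℝ≥0∞ := fun k => leb (cell ε y ⁻¹' {k}) with ha
  choose p hp using fun k => exists_adjoint hT (cellSign ε y k)
  have hasum : ∑' k, a k = 1 := tsum_fiber (measurable_cell ε y)
  obtain ⟨q, hqm, hpq, hqsum, hqint⟩ := exists_completion (p := fun k t => ‖(p k).1 t‖ₑ)
    (fun k => (p k).2.1.enorm) (ae_tsum_adjoint_le hT hp) (lintegral_adjoint_le hT hp) hasum
  have habs := measurable_abs_coe (f : L0)
  -- The law of |f| under the density q_k has mass a_k, and these laws add up to the law of |f|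
  -- because the q_k sum to 1.
  let ρ : ℕ → Measure ℝ := fun k => (leb.withDensity (q k)).map fun t => |f t|
  have hρ : ∀ k S, MeasurableSet S → ρ k S = ∫⁻ t in {t | |f t| ∈ S}, q k t ∂leb := by
    intro k S hS
    rw [Measure.map_apply habs hS, withDensity_apply _ (habs hS)]
    rfl
  have hρuniv : ∀ k, ρ k univ = a k := fun k => by
    rw [hρ k _ MeasurableSet.univ]
    refine Eq.trans ?_ (hqint k)
    simp only [mem_univ, ofPred_true, setLIntegral_univ]
  have hmul : ∀ k S, a k * (if a k = 0 then Measure.dirac 0 else (a k)⁻¹ • ρ k) S = ρ k S := by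
    intro k S
    by_cases h0 : a k = 0
    · rw [h0, zero_mul]
      exact (measure_mono_null (subset_univ S) ((hρuniv k).trans h0)).symm
    · rw [if_neg h0, Measure.smul_apply, smul_eq_mul, ← mul_assoc,
        ENNReal.mul_inv_cancel h0 (measure_ne_top _ _), one_mul]
  refine ⟨fun k => if a k = 0 then Measure.dirac 0 else (a k)⁻¹ • ρ k, fun k => ?_, fun k => ?_,
    fun S hS => ?_, fun k h0 => ?_⟩
  · beta_reduce
    by_cases h0 : a k = 0
    · rw [if_pos h0]
      infer_instance
    · rw [if_neg h0]
      refine ⟨?_⟩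
      rw [Measure.smul_apply, hρuniv, smul_eq_mul, ENNReal.inv_mul_cancel h0 (measure_ne_top _ _)]
  · beta_reduce
    by_cases h0 : a k = 0
    · rw [if_pos h0, Measure.dirac_apply' _ measurableSet_Iio]
      simp
    · rw [if_neg h0, Measure.smul_apply, hρ k _ measurableSet_Iio]
      have : {t | |f t| ∈ Iio 0} = ∅ := by
        ext t
        simp
      rw [this]
      simp
  · change ∑' k, a k * _ = _
    simp only [hmul]
    simp only [hρ _ S hS]
    rw [← lintegral_tsum fun k => (hqm k).aemeasurable, law_apply (f : L0) hS,
      lintegral_congr_ae (ae_restrict_of_ae hqsum)]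
    simp
  · change a k ≠ 0 at h0
    simp only [if_neg h0]
    rw [lintegral_smul_measure, smul_eq_mul, lintegral_map ENNReal.measurable_ofReal habs,
      lintegral_withDensity_eq_lintegral_mul _ (hqm k) habs.ennreal_ofReal,
      mul_comm (a k)⁻¹, ← div_eq_mul_inv, ENNReal.le_div_iff_mul_le (Or.inl h0) (Or.inl (measure_ne_top _ _))]
    refine (le_lintegral_adjoint_mul hε hTy.symm hp k).trans (lintegral_mono fun t => ?_)
    exact mul_le_mul_left (hpq k t) _

/-! ### Rotations of the unit interval -/

/-- Translation invariance of Haar measure on the circle, read on a fundamental domain. -/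
theorem lintegral_fract_add {φ : ℝ → ℝ≥0∞} (c : ℝ) :
    ∫⁻ u, φ (Int.fract (u + c)) ∂leb = ∫⁻ u, φ u ∂leb := by
  have hper : Function.Periodic (fun u : ℝ => φ (Int.fract u)) 1 := fun u => by
    simp only [Int.fract_add_one]
  let F : UnitAddCircle → ℝ≥0∞ := hper.lift
  have hIoc : ∀ ψ : ℝ → ℝ≥0∞, ∫⁻ u, ψ u ∂leb = ∫⁻ u in Ioc 0 (0 + 1), ψ u := fun ψ => by
    rw [zero_add, leb, Measure.restrict_congr_set Ioo_ae_eq_Ioc]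
  have h1 : ∫⁻ u, φ (Int.fract (u + c)) ∂leb = ∫⁻ b, F (b + (c : UnitAddCircle)) := by
    rw [hIoc, ← UnitAddCircle.lintegral_preimage 0]
    rfl
  have h2 : ∫⁻ u, φ u ∂leb = ∫⁻ b, F b := by
    rw [← UnitAddCircle.lintegral_preimage 0, ← hIoc]
    refine setLIntegral_congr_fun measurableSet_Ioo fun u hu => ?_
    change φ u = φ (Int.fract u)
    rw [Int.fract_eq_self.2 ⟨hu.1.le, hu.2⟩]
  rw [h1, h2, lintegral_add_right_eq_self]

/-! ### A uniform variable on each cell of a partition -/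

theorem leb_Ioi {s : ℝ} (hs : 0 ≤ s) : leb (Ioi s) = ENNReal.ofReal (1 - s) := by
  rw [Measure.restrict_apply measurableSet_Ioi]
  have : Ioi s ∩ Ioo 0 1 = Ioo s 1 := by
    ext t
    simp only [mem_inter_iff, mem_Ioi, mem_Ioo]
    exact ⟨fun h => ⟨h.1, h.2.2⟩, fun h => ⟨h.1, hs.trans_lt h.1, h.2⟩⟩
  rw [this, Real.volume_Ioo]

theorem leb_Iio_zero : leb (Iio 0) = 0 := by
  rw [Measure.restrict_apply measurableSet_Iio]
  convert measure_empty (μ := volume)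
  ext t
  simp only [mem_inter_iff, mem_Iio, mem_Ioo, mem_empty_iff_false, iff_false]
  intro h
  linarith [h.1, h.2.1]

/-- The tail function of a normalized restriction of Lebesgue measure is uniformly distributed. -/
theorem map_tail_eq {A : Set ℝ} (h0 : leb A ≠ 0) :
    Measurable (fun t => (leb (A ∩ Ioi t)).toReal / (leb A).toReal) ∧
    ∀ S, MeasurableSet S →
      leb (A ∩ (fun t => (leb (A ∩ Ioi t)).toReal / (leb A).toReal) ⁻¹' S) = leb A * leb S := by
  set a := (leb A).toReal with ha
  have ha0 : 0 < a := ENNReal.toReal_pos h0 (measure_ne_top _ _)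
  set V : ℝ → ℝ := fun t => (leb (A ∩ Ioi t)).toReal / a with hV
  have hanti : Antitone V := fun s t hst => by
    refine div_le_div_of_nonneg_right (ENNReal.toReal_mono (measure_ne_top _ _) ?_) ha0.le
    exact measure_mono (inter_subset_inter_right _ (Ioi_subset_Ioi hst))
  have hVm : Measurable V := hanti.measurable
  refine ⟨hVm, ?_⟩
  -- Passing from s to t loses at most the length t - s of mass. Hence V is continuous and takes
  -- every value in [0, 1].
  have hlip : ∀ s t, s ≤ t → V s - V t ≤ (t - s) / a := by
    intro s t hst
    rw [hV]
    simp only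
    rw [← sub_div]
    refine div_le_div_of_nonneg_right ?_ ha0.le
    have h1 : leb (A ∩ Ioi s) ≤ leb (A ∩ Ioi t) + ENNReal.ofReal (t - s) := by
      have hsub : A ∩ Ioi s ⊆ (A ∩ Ioi t) ∪ Ioc s t := fun u hu => by
        rcases le_or_gt u t with h | h
        · exact Or.inr ⟨hu.2, h⟩
        · exact Or.inl ⟨hu.1, h⟩
      refine (measure_mono hsub).trans ((measure_union_le _ _).trans (add_le_add le_rfl ?_))
      exact (Measure.restrict_apply_le _ _).trans (Real.volume_Ioc).le
    have h2 := ENNReal.toReal_mono (by finiteness) h1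
    rw [ENNReal.toReal_add (measure_ne_top _ _) ENNReal.ofReal_ne_top,
      ENNReal.toReal_ofReal (sub_nonneg.2 hst)] at h2
    linarith
  have hcont : Continuous V := by
    refine (LipschitzWith.of_le_add_mul' (1 / a) fun s t => ?_).continuous
    rw [Real.dist_eq]
    rcases le_total s t with h | h
    · have := hlip s t h
      rw [abs_sub_comm, abs_of_nonneg (sub_nonneg.2 h), one_div_mul_eq_div]
      linarith
    · have := hanti h
      have h2 : 0 ≤ 1 / a * |s - t| := by positivity
      linarith
  have hV0 : V 0 = 1 := by
    have : leb (A ∩ Ioi 0) = leb A := by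
      refine measure_congr ?_
      filter_upwards [ae_restrict_mem (μ := volume) (measurableSet_Ioo (a := (0 : ℝ)) (b := 1))]
        with t ht
      exact propext ⟨fun h => h.1, fun h => ⟨h, ht.1⟩⟩
    rw [hV]
    simp only [this]
    exact div_self ha0.ne'
  have hV1 : V 1 = 0 := by
    have : leb (A ∩ Ioi 1) = 0 :=
      measure_mono_null inter_subset_right (by rw [leb_Ioi zero_le_one]; simp)
    rw [hV]
    simp [this]
  have hVnn : ∀ t, 0 ≤ V t := fun t => div_nonneg ENNReal.toReal_nonneg ha0.le
  have hVle : ∀ t, V t ≤ 1 := fun t => by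
    rw [hV]
    simp only
    rw [div_le_one ha0]
    exact ENNReal.toReal_mono (measure_ne_top _ _) (measure_mono inter_subset_left)
  have hmass : ∀ s, leb (A ∩ Ioi s) = leb A * ENNReal.ofReal (V s) := fun s => by
    rw [hV]
    simp only
    rw [← ENNReal.ofReal_toReal (measure_ne_top leb A), ← ENNReal.ofReal_mul ha0.le,
      mul_div_cancel₀ _ ha0.ne', ENNReal.ofReal_toReal (measure_ne_top _ _)]
  have hIio : ∀ s, leb (A ∩ Iic s) = leb A * ENNReal.ofReal (1 - V s) := fun s => by
    have h1 : leb (A ∩ Iic s) + leb (A ∩ Ioi s) = leb A := by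
      rw [← measure_inter_add_sdiff A (measurableSet_Iic (a := s)), sdiff_eq, compl_Iic]
    have h2 : leb A * ENNReal.ofReal (1 - V s) + leb (A ∩ Ioi s) = leb A := by
      rw [hmass, ← mul_add, ← ENNReal.ofReal_add (sub_nonneg.2 (hVle s)) (hVnn s),
        sub_add_cancel, ENNReal.ofReal_one, mul_one]
    exact (ENNReal.add_left_inj (measure_ne_top _ _)).1 (h1.trans h2.symm)
  have hivt : ∀ s, 0 ≤ s → s ≤ 1 → ∃ b, V b = s := fun s hs0 hs1 => by
    obtain ⟨b, -, hb⟩ := intermediate_value_Icc' zero_le_one hcont.continuousOn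
      (show s ∈ Icc (V 1) (V 0) by rw [hV0, hV1]; exact ⟨hs0, hs1⟩)
    exact ⟨b, hb⟩
  have htail : ∀ s, 0 ≤ s → leb (A ∩ V ⁻¹' Ioi s) = leb A * leb (Ioi s) := by
    intro s hs
    rw [leb_Ioi hs]
    rcases lt_or_ge s 1 with hs1 | hs1
    · refine le_antisymm ?_ ?_
      · obtain ⟨b, hb⟩ := hivt s hs hs1.le
        rw [← hb, ← hIio]
        refine measure_mono fun u hu => ⟨hu.1, ?_⟩
        by_contra hlt
        exact absurd (hanti (not_le.1 hlt).le) (not_le.2 hu.2)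
      -- V may have flat pieces, so {V > s} is bounded from below through levels r > s, which then
      -- decrease to s.
      · have hlim : Tendsto (fun r => leb A * ENNReal.ofReal (1 - r)) (𝓝[>] s)
            (𝓝 (leb A * ENNReal.ofReal (1 - s))) := by
          refine ENNReal.Tendsto.const_mul ?_ (Or.inr (measure_ne_top _ _))
          refine (ENNReal.continuous_ofReal.tendsto _).comp ?_
          exact ((continuous_const.sub continuous_id).tendsto s).mono_left nhdsWithin_le_nhds
        refine le_of_tendsto hlim ?_
        filter_upwards [Ioo_mem_nhdsGT hs1] with r hr
        obtain ⟨b, hb⟩ := hivt r (hs.trans hr.1.le) hr.2.le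
        rw [← hb, ← hIio]
        refine measure_mono fun u hu => ⟨hu.1, ?_⟩
        exact (hr.1.trans_eq hb.symm).trans_le (hanti hu.2)
    · rw [ENNReal.ofReal_of_nonpos (by linarith), mul_zero]
      refine measure_mono_null (fun u hu => ?_) measure_empty
      exact absurd (hVle u) (not_le.2 (lt_of_le_of_lt hs1 hu.2))
  let μ : Measure ℝ := (leb.restrict A).map V
  have hμ : ∀ S, MeasurableSet S → μ S = leb (A ∩ V ⁻¹' S) := fun S hS => by
    rw [Measure.map_apply hVm hS, Measure.restrict_apply (hVm hS), inter_comm]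
  have key : μ = leb A • leb := by
    refine measure_ext_of_tail (fun s hs => ?_) ?_ ?_ ?_
    · rw [hμ _ measurableSet_Ioi, htail s hs]
      rfl
    · rw [hμ _ MeasurableSet.univ]
      simp
    · rw [hμ _ measurableSet_Iio]
      refine measure_mono_null (fun u hu => ?_) measure_empty
      exact absurd (hVnn u) (not_le.2 hu.2)
    · rw [Measure.smul_apply, leb_Iio_zero, smul_zero]
  intro S hS
  rw [← hμ S hS, key]
  rfl

/-- The variable U is uniform on (0,1) and independent of the cell index; it is the randomness from
which the X_j are built. -/
theorem exists_uniform {κ : ℝ → ℕ} (hκ : Measurable κ) :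
    ∃ U : ℝ → ℝ, Measurable U ∧ ∀ k S, MeasurableSet S →
      leb (κ ⁻¹' {k} ∩ U ⁻¹' S) = leb (κ ⁻¹' {k}) * leb S := by
  have h : ∀ k, ∃ V : ℝ → ℝ, Measurable V ∧ ∀ S, MeasurableSet S →
      leb (κ ⁻¹' {k} ∩ V ⁻¹' S) = leb (κ ⁻¹' {k}) * leb S := by
    intro k
    by_cases h0 : leb (κ ⁻¹' {k}) = 0
    · refine ⟨id, measurable_id, fun S _ => ?_⟩
      rw [h0, zero_mul]
      exact measure_mono_null inter_subset_left h0
    · exact ⟨_, map_tail_eq h0⟩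
  choose V hVm hV using h
  refine ⟨fun t => V (κ t) t, ?_, fun k S hS => ?_⟩
  · exact (measurable_from_prod_countable_right (f := fun p : ℕ × ℝ => V p.1 p.2) hVm).comp
      (hκ.prodMk measurable_id)
  · rw [← hV k S hS]
    congr 1
    ext t
    simp only [mem_inter_iff, mem_preimage, mem_singleton_iff]
    constructor
    · rintro ⟨rfl, h⟩
      exact ⟨rfl, h⟩
    · rintro ⟨rfl, h⟩
      exact ⟨rfl, h⟩

/-! ### Riemann sums of decreasing functions over rotated grids -/

/-- Both sides sum an N-periodic function on the integers over a full period, starting at different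
places. -/
theorem sum_fract_eq {α : Type*} [AddCommMonoid α] (P : ℝ → α) {N : ℕ} (hN : 0 < N) (u : ℝ) :
    ∑ j ∈ Finset.range N, P (Int.fract (u + j / N)) =
      ∑ m ∈ Finset.range N, P ((m + Int.fract (N * u)) / N) := by
  have hN' : (0 : ℝ) < N := by exact_mod_cast hN
  set v := Int.fract (N * u) with hv
  let Q : ℤ → α := fun m => P (Int.fract ((m + v) / N))
  have hQ : ∀ m, Q (m + N) = Q m := fun m => by
    simp only [Q]
    have : (((m + N : ℤ) : ℝ) + v) / N = (m + v) / N + 1 := by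
      push_cast
      field_simp
      ring
    rw [this, Int.fract_add_one]
  let S : ℤ → α := fun i => ∑ j ∈ Finset.range N, Q (i + j)
  have hS1 : ∀ i, S (i + 1) = S i := fun i => by
    obtain ⟨M, rfl⟩ := Nat.exists_eq_succ_of_ne_zero hN.ne'
    simp only [S]
    rw [Finset.sum_range_succ, Finset.sum_range_succ']
    congr 1
    · refine Finset.sum_congr rfl fun j _ => ?_
      push_cast
      ring_nf
    · have := hQ i
      push_cast at this ⊢
      rw [add_zero, ← this]
      ring_nf
  have hS : ∀ i, S i = S 0 := fun i => by
    induction i using Int.induction_on with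
    | zero => rfl
    | succ i ih => rw [hS1, ih]
    | pred i ih => rw [← ih, ← hS1 (-(i : ℤ) - 1), sub_add_cancel]
  have h1 : ∑ j ∈ Finset.range N, P (Int.fract (u + j / N)) = S ⌊N * u⌋ := by
    refine Finset.sum_congr rfl fun j _ => ?_
    simp only [Q]
    congr 2
    have : (⌊N * u⌋ : ℝ) + v = N * u := Int.floor_add_fract _
    have e : ((⌊N * u⌋ + j : ℤ) : ℝ) + v = N * u + j := by
      push_cast
      linarith
    rw [e, add_div, mul_div_cancel_left₀ _ hN'.ne']
  have h2 : ∑ m ∈ Finset.range N, P ((m + v) / N) = S 0 := by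
    refine Finset.sum_congr rfl fun j hj => ?_
    simp only [Q, zero_add]
    congr 1
    symm
    rw [Int.cast_natCast, Int.fract_eq_self]
    have hj : (j : ℝ) + 1 ≤ N := by exact_mod_cast Finset.mem_range.1 hj
    have hv0 : 0 ≤ v := Int.fract_nonneg _
    have hv1 : v < 1 := Int.fract_lt_one _
    refine ⟨by positivity, ?_⟩
    rw [div_lt_one hN']
    linarith
  rw [h1, h2, hS]

/-- The rotated grid has one point in each interval of length 1/N, and the value there dominates G
on the next interval. Only the first interval is left over. The condition on u keeps the first grid
point away from 0, where monotonicity is not assumed. -/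
theorem lintegral_le_add_riemann {G : ℝ → ℝ} (hG : ∀ s t, 0 < s → s ≤ t → G t ≤ G s)
    {N : ℕ} (hN : 0 < N) {u : ℝ} (hu : Int.fract (N * u) ≠ 0) :
    ∫⁻ t, ENNReal.ofReal (G t) ∂leb ≤ (∫⁻ t in Ioc 0 (1 / (N : ℝ)), ENNReal.ofReal (G t)) +
      ENNReal.ofReal (1 / N) *
        ∑ j ∈ Finset.range N, ENNReal.ofReal (G (Int.fract (u + j / N))) := by
  have hN' : (0 : ℝ) < N := by exact_mod_cast hN
  rw [sum_fract_eq (fun r => ENNReal.ofReal (G r)) hN]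
  set v := Int.fract (N * u) with hv
  have hv0 : 0 < v := lt_of_le_of_ne (Int.fract_nonneg _) hu.symm
  have hv1 : v < 1 := Int.fract_lt_one _
  -- With M terms the sum controls G up to (M + 1)/N, so M = N covers one interval more than needed.
  have hind : ∀ M : ℕ, ∫⁻ t in Ioc 0 (((M : ℝ) + 1) / N), ENNReal.ofReal (G t) ≤
      (∫⁻ t in Ioc 0 (1 / (N : ℝ)), ENNReal.ofReal (G t)) +
      ENNReal.ofReal (1 / N) *
        ∑ m ∈ Finset.range M, ENNReal.ofReal (G ((m + v) / N)) := by
    intro M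
    induction M with
    | zero => simp
    | succ M ih =>
      have h1 : (0 : ℝ) ≤ ((M : ℝ) + 1) / N := by positivity
      have h2 : ((M : ℝ) + 1) / N ≤ (((M + 1 : ℕ) : ℝ) + 1) / N := by
        push_cast
        gcongr
        linarith
      rw [← Ioc_union_Ioc_eq_Ioc h1 h2, Finset.sum_range_succ, mul_add, ← add_assoc]
      refine (lintegral_union_le _ _ _).trans (add_le_add ih ?_)
      have h3 : ∫⁻ t in Ioc (((M : ℝ) + 1) / N) ((((M + 1 : ℕ) : ℝ) + 1) / N),
          ENNReal.ofReal (G t) ≤ ∫⁻ t in Ioc (((M : ℝ) + 1) / N) ((((M + 1 : ℕ) : ℝ) + 1) / N),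
            ENNReal.ofReal (G ((M + v) / N)) := by
        refine setLIntegral_mono measurable_const fun t ht => ENNReal.ofReal_le_ofReal ?_
        refine hG _ _ (by positivity) (le_trans ?_ ht.1.le)
        gcongr
      refine h3.trans (le_of_eq ?_)
      rw [setLIntegral_const, Real.volume_Ioc, mul_comm]
      congr 2
      push_cast
      field_simp
      ring
  have hsub : Ioo (0 : ℝ) 1 ⊆ Ioc 0 (((N : ℝ) + 1) / N) := fun t ht => by
    refine ⟨ht.1, ht.2.le.trans ?_⟩
    rw [le_div_iff₀ hN']
    linarith
  exact (lintegral_mono_set hsub).trans (hind N)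

/-! ### Truncated integrals of quantiles -/

/-- The layer-cake formula. Its right side is visibly concave in ν, which yields the inequality for
mixtures in `tsum_lintegral_quantile_sub_le`. -/
theorem lintegral_quantile_sub (ν : Measure ℝ) [IsFiniteMeasure ν] (b : ℝ) {L : ℝ} (hL : 0 ≤ L) :
    ∫⁻ u in Ioo 0 b, ENNReal.ofReal (quantile ν u - L) =
      ∫⁻ s in Ioi 0, min (ENNReal.ofReal b) (ν (Ioi (s + L))) := by
  have hm : Measurable fun u => max (quantile ν u - L) 0 :=
    ((measurable_quantile ν).sub_const L).max measurable_const
  have h1 : ∀ r : ℝ, ENNReal.ofReal r = ENNReal.ofReal (max r 0) := fun r => by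
    simp [ENNReal.ofReal_max]
  simp only [h1 (quantile ν _ - L)]
  rw [lintegral_eq_lintegral_meas_lt _ (f := fun u => max (quantile ν u - L) 0)
    (ae_of_all _ fun _ => le_max_right _ _) hm.aemeasurable]
  refine setLIntegral_congr_fun measurableSet_Ioi fun s hs => ?_
  have hs0 : (0 : ℝ) < s := hs
  rw [Measure.restrict_apply (measurableSet_lt measurable_const hm), inter_comm,
    ← volume_quantile_gt ν (add_nonneg hs0.le hL) b]
  congr 2
  ext u
  simp only [mem_ofPred_eq, lt_max_iff]
  constructor
  · rintro (h | h)
    · linarith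
    · linarith
  · intro h
    exact Or.inl (by linarith)

/-! ### Mixtures of quantiles along a partition -/

theorem lintegral_uniform {κ : ℝ → ℕ} (hκ : Measurable κ) {U : ℝ → ℝ} (hU : Measurable U)
    (hun : ∀ k S, MeasurableSet S → leb (κ ⁻¹' {k} ∩ U ⁻¹' S) = leb (κ ⁻¹' {k}) * leb S)
    {φ : ℕ → ℝ → ℝ≥0∞} (hφ : ∀ k, Measurable (φ k)) :
    ∫⁻ t, φ (κ t) (U t) ∂leb = ∑' k, leb (κ ⁻¹' {k}) * ∫⁻ u, φ k u ∂leb := by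
  rw [← tsum_lintegral_fiber hκ]
  refine tsum_congr fun k => ?_
  have h1 : ∫⁻ t in κ ⁻¹' {k}, φ (κ t) (U t) ∂leb = ∫⁻ t in κ ⁻¹' {k}, φ k (U t) ∂leb :=
    setLIntegral_congr_fun (hκ (measurableSet_singleton k)) fun t ht => by
      simp only [show κ t = k from ht]
  have h2 : (leb.restrict (κ ⁻¹' {k})).map U = leb (κ ⁻¹' {k}) • leb := by
    refine Measure.ext fun S hS => ?_
    rw [Measure.map_apply hU hS, Measure.restrict_apply (hU hS), inter_comm, hun k S hS]
    rfl
  rw [h1, ← lintegral_map (hφ k) hU, h2, lintegral_smul_measure, smul_eq_mul]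

theorem lintegral_mixture {x : L0} {a : ℕ → ℝ≥0∞} {ν : ℕ → Measure ℝ}
    (hmix : ∀ S, MeasurableSet S → ∑' k, a k * ν k S = law x S) (φ : ℝ → ℝ≥0∞) :
    ∑' k, a k * ∫⁻ s, φ s ∂(ν k) = ∫⁻ s, φ s ∂(law x) := by
  have : law x = Measure.sum fun k => a k • ν k := by
    refine Measure.ext fun S hS => ?_
    rw [Measure.sum_apply _ hS, ← hmix S hS]
    rfl
  rw [this, lintegral_sum_measure]
  simp only [lintegral_smul_measure, smul_eq_mul]

theorem tsum_lintegral_quantile_sub_le {x : L0} {a : ℕ → ℝ≥0∞} (ha : ∑' k, a k = 1)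
    {ν : ℕ → Measure ℝ} [∀ k, IsProbabilityMeasure (ν k)]
    (hmix : ∀ S, MeasurableSet S → ∑' k, a k * ν k S = law x S) (b : ℝ) {L : ℝ} (hL : 0 ≤ L) :
    ∑' k, a k * ∫⁻ u in Ioo 0 b, ENNReal.ofReal (quantile (ν k) u - L) ≤
      ∫⁻ u in Ioo 0 b, ENNReal.ofReal (quantile (law x) u - L) := by
  have hm : ∀ ν : Measure ℝ, Measurable fun s : ℝ => min (ENNReal.ofReal b) (ν (Ioi (s + L))) := by
    intro ν
    have : Antitone fun s : ℝ => ν (Ioi (s + L)) := fun s t hst =>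
      measure_mono (Ioi_subset_Ioi (by linarith))
    exact measurable_const.min this.measurable
  simp only [lintegral_quantile_sub _ b hL]
  simp only [← lintegral_const_mul _ (hm _)]
  rw [← lintegral_tsum fun k => ((hm (ν k)).const_mul (a k)).aemeasurable]
  refine lintegral_mono fun s => le_min ?_ ?_
  · calc ∑' k, a k * min (ENNReal.ofReal b) (ν k (Ioi (s + L)))
        ≤ ∑' k, a k * ENNReal.ofReal b :=
          ENNReal.tsum_le_tsum fun k => by gcongr; exact min_le_left _ _
      _ = ENNReal.ofReal b := by rw [ENNReal.tsum_mul_right, ha, one_mul]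
  · rw [← hmix _ measurableSet_Ioi]
    exact ENNReal.tsum_le_tsum fun k => by gcongr; exact min_le_right _ _

/-- Every member of the orbit of `x` is dominated, up to a small error, by the average of `N`
functions that are equimeasurable with `|x|`. -/
theorem exists_dominating_average {x y : L0} (hy : y ∈ orbit x) {ε : ℝ} (hε : 0 < ε) {N : ℕ}
    (hN : 0 < N) :
    ∃ (X : ℕ → L0) (H : L0), (∀ j, law (X j) = law x) ∧ (∀ j, ∀ᵐ t ∂leb, 0 ≤ X j t) ∧
      (∀ᵐ t ∂leb, 0 ≤ H t) ∧
      (∀ᵐ t ∂leb, |y t| ≤ ε + H t + 1 / N * ∑ j ∈ Finset.range N, X j t) ∧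
      ∀ l : ℝ, 0 ≤ l → ∫⁻ t, ENNReal.ofReal (|H t| - l) ∂leb ≤
        ∫⁻ u in Ioo 0 (1 / (N : ℝ)), ENNReal.ofReal (quantile (law x) u - N * l) := by
  have hN' : (0 : ℝ) < N := by exact_mod_cast hN
  obtain ⟨ν, hprob, hν0, hmix, hmean⟩ := exists_level_laws hy hε
  set κ := cell ε y with hκdef
  have hκ : Measurable κ := measurable_cell ε y
  obtain ⟨U, hU, hun⟩ := exists_uniform hκ
  have hq : Measurable fun p : ℕ × ℝ => quantile (ν p.1) p.2 :=
    measurable_from_prod_countable_right fun k => measurable_quantile (ν k)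
  have hXm : ∀ j : ℕ, Measurable fun t => quantile (ν (κ t)) (Int.fract (U t + j / N)) := fun j =>
    hq.comp (hκ.prodMk (hU.add_const _).fract)
  -- Within cell k the rotated variable is again uniform, so X_j has law ν_k there and the law of
  -- |x| overall; for fixed t the values over j sample one quantile function on a rotated grid.
  let X : ℕ → L0 := fun j => AEEqFun.mk _ (hXm j).aestronglyMeasurable
  have hXc : ∀ j, X j =ᵐ[leb] fun t => quantile (ν (κ t)) (Int.fract (U t + j / N)) := fun j =>
    AEEqFun.coeFn_mk _ _
  -- The part of the mean of ν_k that the Riemann sum may miss.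
  let h : ℕ → ℝ≥0∞ := fun k => ∫⁻ u in Ioc 0 (1 / (N : ℝ)), ENNReal.ofReal (quantile (ν k) u)
  have hHm : Measurable fun t => (h (κ t)).toReal :=
    (measurable_of_countable fun k => (h k).toReal).comp hκ
  let H : L0 := AEEqFun.mk _ hHm.aestronglyMeasurable
  have hHc : H =ᵐ[leb] fun t => (h (κ t)).toReal := AEEqFun.coeFn_mk _ _
  refine ⟨X, H, fun j => ?_, fun j => ?_, ?_, ?_, fun l hl => ?_⟩
  · refine Measure.ext fun S hS => ?_
    have h1 : law (X j) S = ∫⁻ t, S.indicator 1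
        (quantile (ν (κ t)) (Int.fract (U t + j / N))) ∂leb := by
      rw [law_congr (hXc j)]
      simp only [abs_of_nonneg (quantile_nonneg _ _)]
      rw [← lintegral_map (f := S.indicator 1) (measurable_one.indicator hS) (hXm j),
        lintegral_indicator_one hS]
    have hφ : ∀ k, Measurable fun u => S.indicator (1 : ℝ → ℝ≥0∞) (quantile (ν k) u) := fun k =>
      (measurable_one.indicator hS).comp (measurable_quantile _)
    rw [h1, lintegral_uniform hκ hU hun
      (φ := fun k u => S.indicator 1 (quantile (ν k) (Int.fract (u + j / N))))
      fun k => (hφ k).comp (measurable_id.add_const _).fract, ← hmix S hS]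
    refine tsum_congr fun k => ?_
    rw [lintegral_fract_add (φ := fun u => S.indicator 1 (quantile (ν k) u)),
      ← lintegral_map (f := S.indicator 1) (measurable_one.indicator hS) (measurable_quantile _),
      map_quantile (ν k) (hν0 k), lintegral_indicator_one hS]
  · filter_upwards [hXc j] with t ht
    rw [ht]
    exact quantile_nonneg _ _
  · filter_upwards [hHc] with t ht
    rw [ht]
    exact ENNReal.toReal_nonneg
  · have hgrid : ∀ᵐ t ∂leb, Int.fract (N * U t) ≠ 0 := by
      have hcount : (range fun z : ℤ => (z : ℝ) / N).Countable := countable_range _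
      have h1 : leb (U ⁻¹' range fun z : ℤ => (z : ℝ) / N) = 0 := by
        have h2 : leb (range fun z : ℤ => (z : ℝ) / N) = 0 := by
          exact hcount.measure_zero _
        have h3 : U ⁻¹' (range fun z : ℤ => (z : ℝ) / N) =
            ⋃ k, κ ⁻¹' {k} ∩ U ⁻¹' (range fun z : ℤ => (z : ℝ) / N) := by
          rw [← iUnion_inter, ← preimage_iUnion, iUnion_of_singleton, preimage_univ, univ_inter]
        rw [h3, measure_iUnion_null_iff]
        intro k
        rw [hun k _ hcount.measurableSet, h2, mul_zero]
      have h2 : ∀ᵐ t ∂leb, t ∉ U ⁻¹' range fun z : ℤ => (z : ℝ) / N :=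
        measure_eq_zero_iff_ae_notMem.1 h1
      filter_upwards [h2] with t ht h0
      refine ht ⟨⌊N * U t⌋, ?_⟩
      have := Int.floor_add_fract (N * U t)
      rw [h0, add_zero] at this
      simp only [this]
      field_simp
    have hfin : ∀ k, leb (κ ⁻¹' {k}) ≠ 0 → h k ≠ ∞ := by
      intro k h0 htop
      have h1 : ∑' k, leb (κ ⁻¹' {k}) * ∫⁻ s, ENNReal.ofReal s ∂(ν k) < ∞ := by
        rw [lintegral_mixture hmix, lintegral_law x ENNReal.measurable_ofReal]
        exact mem_L1_iff.1 (mem_L1_of_mem_orbit hy).1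
      have h2 : leb (κ ⁻¹' {k}) * ∫⁻ s, ENNReal.ofReal s ∂(ν k) < ∞ :=
        (ENNReal.le_tsum k).trans_lt h1
      have h3 : h k ≤ ∫⁻ s, ENNReal.ofReal s ∂(ν k) := by
        rw [← map_quantile (ν k) (hν0 k), lintegral_map ENNReal.measurable_ofReal
          (measurable_quantile _), leb,
          Measure.restrict_congr_set Ioo_ae_eq_Ioc]
        refine lintegral_mono_set (Ioc_subset_Ioc_right ?_)
        rw [div_le_one hN']
        exact_mod_cast hN
      rw [htop, top_le_iff] at h3
      rw [h3, ENNReal.mul_top h0] at h2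
      exact lt_irrefl _ h2
    filter_upwards [hHc, ae_all_iff.2 hXc, hgrid, ae_fiber_ne_zero hκ] with t hH hX hg h0
    have h1 := hmean (κ t) h0
    rw [← map_quantile (ν (κ t)) (hν0 _), lintegral_map ENNReal.measurable_ofReal
      (measurable_quantile _)] at h1
    have h2 := h1.trans (lintegral_le_add_riemann
      (fun s t hs hst => quantile_anti (ν (κ _)) hs hst) hN hg)
    rw [← ENNReal.ofReal_sum_of_nonneg fun _ _ => quantile_nonneg _ _,
      ← ENNReal.ofReal_mul (by positivity)] at h2
    have hsum : 0 ≤ 1 / (N : ℝ) *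
        ∑ j ∈ Finset.range N, quantile (ν (κ t)) (Int.fract (U t + j / N)) :=
      mul_nonneg (by positivity) (Finset.sum_nonneg fun _ _ => quantile_nonneg _ _)
    have h3 : κ t * ε ≤ (h (κ t)).toReal + 1 / (N : ℝ) *
        ∑ j ∈ Finset.range N, quantile (ν (κ t)) (Int.fract (U t + j / N)) := by
      rw [← ENNReal.ofReal_le_ofReal_iff (add_nonneg ENNReal.toReal_nonneg hsum),
        ENNReal.ofReal_add ENNReal.toReal_nonneg hsum, ENNReal.ofReal_toReal (hfin _ h0)]
      exact h2
    have h4 := (cell_bounds hε y t).2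
    rw [← hκdef] at h4
    rw [hH, Finset.sum_congr rfl fun j _ => hX j]
    linarith
  · have hNl : 0 ≤ N * l := by positivity
    -- The number l is spread over (0, 1/N) as the constant N·l, so the excess of an integral is at
    -- most the integral of the excess.
    have h1 : ∀ k, ENNReal.ofReal ((h k).toReal - l) ≤
        ∫⁻ u in Ioo 0 (1 / (N : ℝ)), ENNReal.ofReal (quantile (ν k) u - N * l) := by
      intro k
      rw [ENNReal.ofReal_sub _ hl, tsub_le_iff_left]
      refine ENNReal.ofReal_toReal_le.trans ?_
      have h2 : h k = ∫⁻ u in Ioo 0 (1 / (N : ℝ)), ENNReal.ofReal (quantile (ν k) u) := by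
        simp only [h]
        rw [Measure.restrict_congr_set Ioo_ae_eq_Ioc]
      have h3 : ENNReal.ofReal l = ∫⁻ u in Ioo 0 (1 / (N : ℝ)), ENNReal.ofReal (N * l) := by
        rw [setLIntegral_const, Real.volume_Ioo, ← ENNReal.ofReal_mul hNl]
        congr 1
        field_simp
        ring
      rw [h2, h3, ← lintegral_add_left measurable_const]
      refine lintegral_mono fun u => le_trans (le_of_eq ?_) ENNReal.ofReal_add_le
      ring_nf
    have h2 : ∫⁻ t, ENNReal.ofReal (|H t| - l) ∂leb =
        ∫⁻ t, ENNReal.ofReal ((h (κ t)).toReal - l) ∂leb := by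
      refine lintegral_congr_ae ?_
      filter_upwards [hHc] with t ht
      rw [ht, abs_of_nonneg ENNReal.toReal_nonneg]
    rw [h2, lintegral_comp_nat hκ fun k => ENNReal.ofReal ((h k).toReal - l)]
    refine le_trans (ENNReal.tsum_le_tsum fun k => ?_)
      (tsum_lintegral_quantile_sub_le (tsum_fiber hκ) hmix (1 / (N : ℝ)) hNl)
    rw [mul_comm]
    gcongr
    exact h1 k

/-! ### Multiplication of convex combinations of equimeasurable functions -/

/-- The functions equimeasurable with `x` in absolute value. -/
def equimeasurable (x : L0) : Set L0 := {z | law z = law x}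

theorem law_mul_of_abs_eq_one {s z : L0} (hs : ∀ᵐ t ∂leb, |s t| = 1) : law (s * z) = law z := by
  refine Measure.map_congr ?_
  filter_upwards [hs, AEEqFun.coeFn_mul s z] with t h1 h2
  rw [h2, Pi.mul_apply, abs_mul, h1, one_mul]

/-- Multiplication by a function, as a linear map. -/
def mulBy (s : L0) : L0 →ₗ[ℝ] L0 where
  toFun z := s * z
  map_add' z w := by
    refine AEEqFun.ext ?_
    filter_upwards [AEEqFun.coeFn_mul s (z + w), AEEqFun.coeFn_add z w, AEEqFun.coeFn_mul s z,
      AEEqFun.coeFn_mul s w, AEEqFun.coeFn_add (s * z) (s * w)] with t h1 h2 h3 h4 h5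
    rw [h1, h5, Pi.mul_apply, Pi.add_apply, h2, h3, h4, Pi.add_apply, Pi.mul_apply, Pi.mul_apply,
      mul_add]
  map_smul' c z := by
    refine AEEqFun.ext ?_
    filter_upwards [AEEqFun.coeFn_mul s (c • z), AEEqFun.coeFn_smul c z, AEEqFun.coeFn_mul s z,
      AEEqFun.coeFn_smul c (s * z)] with t h1 h2 h3 h4
    rw [RingHom.id_apply, h1, h4, Pi.mul_apply, Pi.smul_apply, h2, h3, Pi.smul_apply, Pi.mul_apply,
      smul_eq_mul, smul_eq_mul]
    ring

theorem mul_mem_convexHull {x s k : L0} (hs : ∀ᵐ t ∂leb, |s t| = 1)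
    (hk : k ∈ convexHull ℝ (equimeasurable x)) : s * k ∈ convexHull ℝ (equimeasurable x) := by
  have h := mem_image_of_mem (mulBy s) hk
  rw [LinearMap.image_convexHull] at h
  refine convexHull_mono ?_ h
  rintro _ ⟨z, hz, rfl⟩
  exact (law_mul_of_abs_eq_one hs).trans hz

/-- Binary expansion: m = (s + m')/2 with s = sgn m, and m' = 2m - s is again bounded by 1. The
product s·w stays in the hull and each step halves the error, which starts from |m - 1| ≤ 2. -/
theorem exists_mem_convexHull_mul {x w : L0} (hw : w ∈ convexHull ℝ (equimeasurable x)) (n : ℕ) :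
    ∀ m : ℝ → ℝ, Measurable m → (∀ t, |m t| ≤ 1) →
      ∃ k ∈ convexHull ℝ (equimeasurable x),
        ∀ᵐ t ∂leb, |m t * w t - k t| ≤ 2 * (1 / 2) ^ n * |w t| := by
  induction n with
  | zero =>
    intro m _ hm
    refine ⟨w, hw, ae_of_all _ fun t => ?_⟩
    rw [pow_zero, mul_one, ← sub_one_mul, abs_mul]
    refine mul_le_mul_of_nonneg_right ?_ (abs_nonneg _)
    refine (abs_sub _ _).trans ?_
    rw [abs_one]
    linarith [hm t]
  | succ n ih =>
    intro m hmm hm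
    have hsm : Measurable fun t => sgn (m t) := measurable_sgn.comp hmm
    let s : L0 := AEEqFun.mk _ hsm.aestronglyMeasurable
    have hsc : s =ᵐ[leb] fun t => sgn (m t) := AEEqFun.coeFn_mk _ _
    obtain ⟨k, hk, hkw⟩ := ih (fun t => 2 * m t - sgn (m t)) ((hmm.const_mul 2).sub hsm) fun t => by
      have := abs_le.1 (hm t)
      unfold sgn
      rw [abs_le]
      split_ifs with h
      · constructor <;> linarith
      · constructor <;> linarith
    have hsw : s * w ∈ convexHull ℝ (equimeasurable x) := by
      refine mul_mem_convexHull ?_ hw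
      filter_upwards [hsc] with t ht
      rw [ht, abs_sgn]
    refine ⟨(1 / 2 : ℝ) • (s * w) + (1 / 2 : ℝ) • k,
      convex_convexHull ℝ _ hsw hk (by norm_num) (by norm_num) (by norm_num), ?_⟩
    filter_upwards [hkw, hsc, AEEqFun.coeFn_mul s w, AEEqFun.coeFn_smul (1 / 2 : ℝ) (s * w),
      AEEqFun.coeFn_smul (1 / 2 : ℝ) k,
      AEEqFun.coeFn_add ((1 / 2 : ℝ) • (s * w)) ((1 / 2 : ℝ) • k)] with t h1 h2 h3 h4 h5 h6
    rw [h6, Pi.add_apply, h4, h5, Pi.smul_apply, Pi.smul_apply, h3, Pi.mul_apply, h2]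
    have e : m t * w t - ((1 / 2 : ℝ) • (sgn (m t) * w t) + (1 / 2 : ℝ) • k t) =
        1 / 2 * ((2 * m t - sgn (m t)) * w t - k t) := by
      simp only [smul_eq_mul]
      ring
    rw [e, abs_mul, abs_of_pos (by norm_num : (0 : ℝ) < 1 / 2), pow_succ]
    linarith

theorem coeFn_sum (X : ℕ → L0) (N : ℕ) :
    (∑ j ∈ Finset.range N, X j : L0) =ᵐ[leb] fun t => ∑ j ∈ Finset.range N, X j t := by
  induction N with
  | zero =>
    simp only [Finset.range_zero, Finset.sum_empty]
    exact AEEqFun.coeFn_zero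
  | succ N ih =>
    simp only [Finset.sum_range_succ]
    filter_upwards [ih, AEEqFun.coeFn_add (∑ j ∈ Finset.range N, X j) (X N)] with t h1 h2
    rw [h2, Pi.add_apply, h1]

theorem average_mem_convexHull {x : L0} {X : ℕ → L0} (hX : ∀ j, law (X j) = law x) {N : ℕ}
    (hN : 0 < N) : (1 / N : ℝ) • ∑ j ∈ Finset.range N, X j ∈ convexHull ℝ (equimeasurable x) := by
  have hN' : (0 : ℝ) < N := by exact_mod_cast hN
  rw [Finset.smul_sum]
  refine (convex_convexHull ℝ _).sum_mem (fun _ _ => by positivity) ?_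
    fun j _ => subset_convexHull ℝ _ (hX j)
  rw [Finset.sum_const, Finset.card_range, nsmul_eq_mul, mul_one_div_cancel hN'.ne']

theorem equimeasurable_subset_extremePoints {x : L0} (hx : x ∈ Lp ℝ 1 leb) :
    equimeasurable x ⊆ extremePoints ℝ (orbit x) := fun _ hz => mem_extremePoints_orbit hx hz

theorem convexHull_equimeasurable_subset {x : L0} (hx : x ∈ Lp ℝ 1 leb) :
    convexHull ℝ (equimeasurable x) ⊆ orbit x :=
  convexHull_min (fun _ hz => mem_orbit_of_law_eq hx hz) (orbit_convex x)

/-! ### Dilations -/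

theorem ae_comp_div {P : ℝ → Prop} (h : ∀ᵐ u ∂leb, P u) {τ : ℝ} (hτ : 1 ≤ τ) :
    ∀ᵐ s ∂leb, P (s / τ) := by
  have hτ0 : 0 < τ := by linarith
  have h1 : ∀ᵐ u ∂volume, u ∈ Ioo (0 : ℝ) 1 → P u := (ae_restrict_iff' measurableSet_Ioo).1 h
  have h2 : ∀ᵐ u ∂(Measure.map (fun s : ℝ => s * τ⁻¹) volume), u ∈ Ioo (0 : ℝ) 1 → P u := by
    rw [Real.map_volume_mul_right (inv_ne_zero hτ0.ne')]
    exact Measure.ae_smul_measure h1 _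
  have h3 := ae_of_ae_map (measurable_id.mul_const τ⁻¹).aemeasurable h2
  refine (ae_restrict_iff' measurableSet_Ioo).2 ?_
  filter_upwards [h3] with s hs hs01
  rw [div_eq_mul_inv]
  refine hs ⟨mul_pos hs01.1 (inv_pos.2 hτ0), ?_⟩
  change s * τ⁻¹ < 1
  rw [← div_eq_mul_inv, div_lt_one hτ0]
  exact hs01.2.trans_le hτ

theorem coe_dilation {x : L0} {f : ℝ → ℝ} (h : x =ᵐ[leb] f) {τ : ℝ} (hτ : 1 ≤ τ) :
    dilation τ x =ᵐ[leb] fun s => f (s / τ) := by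
  filter_upwards [AEEqFun.coeFn_mk (μ := leb) (fun s => if s ≤ τ then x (s / τ) else 0)
    (Measurable.ite measurableSet_Iic
      (x.stronglyMeasurable.measurable.comp (measurable_id.div_const τ))
      measurable_const).aestronglyMeasurable, ae_comp_div h hτ,
    ae_restrict_mem (μ := volume) (measurableSet_Ioo (a := (0 : ℝ)) (b := 1))] with s h1 h2 h3
  refine h1.trans ?_
  rw [if_pos (h3.2.le.trans hτ), h2]

theorem dilation_smul (c : ℝ) (x : L0) {τ : ℝ} (hτ : 1 ≤ τ) :
    dilation τ (c • x) = c • dilation τ x := by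
  refine AEEqFun.ext ?_
  filter_upwards [coe_dilation (AEEqFun.coeFn_smul c x) hτ,
    coe_dilation (EventuallyEq.refl _ x) hτ, AEEqFun.coeFn_smul c (dilation τ x)] with s h1 h2 h3
  rw [h1, h3, Pi.smul_apply, Pi.smul_apply, h2]

theorem lintegral_comp_div {F : ℝ → ℝ≥0∞} (hF : Measurable F) {τ : ℝ} (hτ : 0 < τ) :
    ∫⁻ s, F (s / τ) ∂leb = ENNReal.ofReal τ * ∫⁻ u in Ioo 0 (1 / τ), F u := by
  have h1 : ∫⁻ s, F (s / τ) ∂leb = ∫⁻ s, (Ioo 0 (1 / τ)).indicator F (s * τ⁻¹) := by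
    rw [← lintegral_indicator measurableSet_Ioo]
    refine lintegral_congr fun s => ?_
    by_cases hs : s ∈ Ioo (0 : ℝ) 1
    · rw [indicator_of_mem hs, indicator_of_mem, div_eq_mul_inv]
      rw [one_div]
      exact ⟨mul_pos hs.1 (inv_pos.2 hτ), mul_lt_of_lt_one_left (inv_pos.2 hτ) hs.2⟩
    · rw [indicator_of_notMem hs, indicator_of_notMem]
      rintro ⟨h2, h3⟩
      rw [one_div] at h3
      exact hs ⟨pos_of_mul_pos_left h2 (inv_pos.2 hτ).le,
        (mul_lt_iff_lt_one_left (inv_pos.2 hτ)).1 h3⟩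
  have hm : Measurable fun s : ℝ => s * τ⁻¹ := measurable_id.mul_const τ⁻¹
  rw [h1, ← lintegral_map (hF.indicator measurableSet_Ioo) hm]
  rw [Real.map_volume_mul_right (inv_ne_zero hτ.ne'), inv_inv, abs_of_pos hτ,
    lintegral_smul_measure, lintegral_indicator measurableSet_Ioo, smul_eq_mul]

/-- Identifies the bound on the excess of H in `exists_dominating_average` as the excess of
N⁻¹σ_N(x*), so that full symmetry applies to H. -/
theorem lintegral_dilation_sub (x : L0) {N : ℕ} (hN : 0 < N) (l : ℝ) :
    ∫⁻ t, ENNReal.ofReal (|((1 / N : ℝ) • dilation N (rearr x) : L0) t| - l) ∂leb =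
      ∫⁻ u in Ioo 0 (1 / (N : ℝ)), ENNReal.ofReal (quantile (law x) u - N * l) := by
  have hN' : (0 : ℝ) < N := by exact_mod_cast hN
  have hN1 : (1 : ℝ) ≤ N := by exact_mod_cast hN
  have hm : Measurable fun u => ENNReal.ofReal (1 / N * quantile (law x) u - l) :=
    (((measurable_quantile _).const_mul _).sub_const l).ennreal_ofReal
  have h1 : ∫⁻ t, ENNReal.ofReal (|((1 / N : ℝ) • dilation N (rearr x) : L0) t| - l) ∂leb =
      ∫⁻ t, ENNReal.ofReal (1 / N * quantile (law x) (t / N) - l) ∂leb := by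
    refine lintegral_congr_ae ?_
    filter_upwards [AEEqFun.coeFn_smul (1 / N : ℝ) (dilation N (rearr x)),
      coe_dilation (coe_rearr x) hN1] with t h1 h2
    rw [h1, Pi.smul_apply, h2, smul_eq_mul,
      abs_of_nonneg (mul_nonneg (by positivity) (quantile_nonneg _ _))]
  rw [h1, lintegral_comp_div (F := fun u => ENNReal.ofReal (1 / N * quantile (law x) u - l)) hm hN',
    ← lintegral_const_mul _ hm]
  refine lintegral_congr fun u => ?_
  rw [← ENNReal.ofReal_mul hN'.le]
  congr 1
  field_simp

/-! ### Approximation in the norm of a fully symmetric space -/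

namespace FunctionSpace

variable {E : FunctionSpace}

theorem IsFullySymmetric.mem_L1 (hE : E.IsFullySymmetric) {x : L0} (hx : x ∈ E.carrier) :
    x ∈ Lp ℝ 1 leb := by
  obtain ⟨C, hC, h⟩ := hE.exists_lintegral_le
  exact mem_L1_iff.2 ((h x hx).trans_lt (ENNReal.mul_lt_top hC.lt_top (enorm_lt_top_iff.2 hx)))

/-- The three terms bound the part of the error truncated at ε, its excess over ε (dominated by H),
and the error of the binary expansion. -/
theorem IsFullySymmetric.exists_enorm_sub_le (hE : E.IsFullySymmetric) {C : ℝ≥0∞}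
    (hC : ∀ x ∈ E.carrier, ∀ l : ℝ, (∀ᵐ t ∂leb, |x t| ≤ l) → E.enorm x ≤ C * ENNReal.ofReal l)
    {x y : L0} (hx : x ∈ E.carrier) (hy : y ∈ orbit x) {ε : ℝ} (hε : 0 < ε) {N : ℕ} (hN : 0 < N)
    (n : ℕ) :
    ∃ k ∈ convexHull ℝ (equimeasurable x), E.enorm (y - k) ≤ C * ENNReal.ofReal ε +
      E.enorm (dilation N (rearr x)) / ENNReal.ofReal N +
        ENNReal.ofReal (2 * (1 / 2) ^ n) * E.enorm x := by
  have hN' : (0 : ℝ) < N := by exact_mod_cast hN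
  have hx1 := hE.mem_L1 hx
  obtain ⟨X, H, hXlaw, hX0, hH0, hyX, hHint⟩ := exists_dominating_average hy hε hN
  let w : L0 := (1 / N : ℝ) • ∑ j ∈ Finset.range N, X j
  have hw : w ∈ convexHull ℝ (equimeasurable x) := average_mem_convexHull hXlaw hN
  have hwc : ∀ᵐ t ∂leb, w t = 1 / N * ∑ j ∈ Finset.range N, X j t := by
    filter_upwards [AEEqFun.coeFn_smul (1 / N : ℝ) (∑ j ∈ Finset.range N, X j), coeFn_sum X N]
      with t h1 h2
    refine h1.trans ?_
    rw [Pi.smul_apply, h2, smul_eq_mul]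
  have hw0 : ∀ᵐ t ∂leb, 0 ≤ w t := by
    filter_upwards [hwc, ae_all_iff.2 hX0] with t h1 h2
    rw [h1]
    exact mul_nonneg (by positivity) (Finset.sum_nonneg fun j _ => h2 j)
  have hworb : w ∈ orbit x := convexHull_equimeasurable_subset hx1 hw
  -- The multiplier makes m·w the truncation of y to [-w, w]; where w = 0 the truncation vanishes
  -- and the value of the quotient is immaterial.
  let m : ℝ → ℝ := fun t => truncate |w t| (y t) / |w t|
  have hmm : Measurable m := by
    have hwm := measurable_abs_coe w
    exact (hwm.neg.max ((measurable_coe y).min hwm)).div hwm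
  have hm1 : ∀ t, |m t| ≤ 1 := fun t => by
    simp only [m]
    rw [abs_div, abs_abs]
    exact div_le_one_of_le₀ (abs_truncate_le (abs_nonneg _) _) (abs_nonneg _)
  obtain ⟨k, hk, hmk⟩ := exists_mem_convexHull_mul hw n m hmm hm1
  refine ⟨k, hk, ?_⟩
  have hem : Measurable fun t => y t - m t * w t :=
    (measurable_coe y).sub (hmm.mul (measurable_coe w))
  let e : L0 := AEEqFun.mk _ hem.aestronglyMeasurable
  have hec : e =ᵐ[leb] fun t => y t - m t * w t := AEEqFun.coeFn_mk _ _
  have hmw : ∀ᵐ t ∂leb, m t * w t = truncate (w t) (y t) := by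
    filter_upwards [hw0] with t ht
    simp only [m]
    rw [abs_of_nonneg ht]
    rcases ht.eq_or_lt with h0 | h0
    · rw [← h0, mul_zero]
      have := abs_truncate le_rfl (y t)
      rw [min_eq_right (abs_nonneg _)] at this
      exact (abs_eq_zero.1 this).symm
    · exact div_mul_cancel₀ _ h0.ne'
  have heabs : ∀ᵐ t ∂leb, |e t| = max (|y t| - w t) 0 := by
    filter_upwards [hec, hmw, hw0] with t h1 h2 h3
    rw [h1, h2]
    have := congrArg ENNReal.toReal (abs_sub_truncate h3 (y t))
    rwa [ENNReal.toReal_ofReal (abs_nonneg _), ENNReal.toReal_ofReal'] at this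
  have hyE := hE.of_mem_orbit hx hy
  have heE : E.enorm e ≤ E.enorm y := by
    refine hE.enorm_mono ?_
    filter_upwards [heabs, hw0] with t h1 h2
    rw [h1]
    exact max_le (by linarith) (abs_nonneg _)
  have hgm : Measurable fun t => m t * w t - k t :=
    (hmm.mul (measurable_coe w)).sub (measurable_coe k)
  let g : L0 := AEEqFun.mk _ hgm.aestronglyMeasurable
  have hgc : g =ᵐ[leb] fun t => m t * w t - k t := AEEqFun.coeFn_mk _ _
  have hsplit : y - k = truncL0 ε e + (e - truncL0 ε e) + g := by
    rw [add_sub_cancel]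
    refine AEEqFun.ext ?_
    filter_upwards [hec, hgc, AEEqFun.coeFn_add e g, AEEqFun.coeFn_sub y k] with t h1 h2 h3 h4
    rw [h3, h4, Pi.add_apply, Pi.sub_apply, h1, h2]
    ring
  have b1 : E.enorm (truncL0 ε e) ≤ C * ENNReal.ofReal ε := by
    refine hC _ (enorm_lt_top_iff.1 ?_) ε (truncL0_bound hε.le e)
    exact ((hE.enorm_truncL0_le hε.le e).trans heE).trans_lt (enorm_lt_top_iff.2 hyE.1)
  have b2 : E.enorm (e - truncL0 ε e) ≤ E.enorm (dilation N (rearr x)) / ENNReal.ofReal N := by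
    have h1 : E.enorm (e - truncL0 ε e) ≤ E.enorm H := by
      refine hE.enorm_mono ?_
      filter_upwards [AEEqFun.coeFn_sub e (truncL0 ε e), coe_truncL0 ε e, heabs, hwc, hyX, hH0]
        with t h1 h2 h3 h4 h5 h6
      rw [h1, Pi.sub_apply, h2]
      have := congrArg ENNReal.toReal (abs_sub_truncate hε.le (e t))
      rw [ENNReal.toReal_ofReal (abs_nonneg _), ENNReal.toReal_ofReal'] at this
      rw [this, h3, abs_of_nonneg h6]
      refine max_le ?_ h6
      rw [sub_le_iff_le_add]
      exact max_le (by linarith) (by linarith)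
    refine h1.trans ?_
    -- If the dilated rearrangement lies outside E, the right side is ∞.
    by_cases hd : dilation N (rearr x) ∈ E.carrier
    · have hD : (1 / N : ℝ) • dilation N (rearr x) ∈ E.carrier := E.carrier.smul_mem _ hd
      have hHD : ∀ l : ℝ, 0 ≤ l → ∫⁻ t, ENNReal.ofReal (|H t| - l) ∂leb ≤
          ∫⁻ t, ENNReal.ofReal (|((1 / N : ℝ) • dilation N (rearr x) : L0) t| - l) ∂leb := by
        intro l hl
        rw [lintegral_dilation_sub x hN]
        exact hHint l hl
      have hH1 : H ∈ Lp ℝ 1 leb := by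
        have := hHD 0 le_rfl
        simp only [sub_zero] at this
        exact mem_L1_iff.2 (this.trans_lt (mem_L1_iff.1 (hE.mem_L1 hD)))
      refine (hE.of_lintegral_le hD hH1 hHD).2.trans (le_of_eq ?_)
      rw [enorm_smul hd, abs_of_pos (by positivity), one_div, ENNReal.ofReal_inv_of_pos hN',
        mul_comm, div_eq_mul_inv]
    · rw [show E.enorm (dilation N (rearr x)) = ∞ from dif_neg hd,
        ENNReal.top_div_of_ne_top ENNReal.ofReal_ne_top]
      exact le_top
  have b3 : E.enorm g ≤ ENNReal.ofReal (2 * (1 / 2) ^ n) * E.enorm x := by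
    have hwE := hE.of_mem_orbit hx hworb
    have hpos : (0 : ℝ) < 2 * (1 / 2) ^ n := by positivity
    have h1 : E.enorm g ≤ E.enorm ((2 * (1 / 2) ^ n : ℝ) • w) := by
      refine hE.enorm_mono ?_
      filter_upwards [hgc, hmk, AEEqFun.coeFn_smul (2 * (1 / 2) ^ n : ℝ) w] with t h1 h2 h3
      rw [h1, h3, Pi.smul_apply, smul_eq_mul, abs_mul, abs_of_pos hpos]
      exact h2
    rw [enorm_smul hwE.1, abs_of_pos hpos] at h1
    exact h1.trans (by gcongr; exact hwE.2)
  rw [hsplit]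
  exact (enorm_add_le _ _).trans (add_le_add ((enorm_add_le _ _).trans (add_le_add b1 b2)) b3)

theorem IsFullySymmetric.exists_enorm_sub_lt (hE : E.IsFullySymmetric) {x y : L0}
    (hx : x ∈ E.carrier) (hφ : Tendsto (fun s : ℝ => E.enorm (dilation s (rearr x)) /
      ENNReal.ofReal s) atTop (𝓝 0)) (hy : y ∈ orbit x) {δ : ℝ≥0∞} (hδ : 0 < δ) :
    ∃ k ∈ convexHull ℝ (equimeasurable x), E.enorm (y - k) < δ := by
  obtain ⟨C, hC, hCb⟩ := hE.exists_enorm_le_of_bound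
  have h1 : Tendsto (fun i : ℕ => C * ENNReal.ofReal (1 / ((i : ℝ) + 1))) atTop (𝓝 0) := by
    have := ENNReal.Tendsto.const_mul
      ((ENNReal.continuous_ofReal.tendsto 0).comp
        (tendsto_one_div_add_atTop_nhds_zero_nat (𝕜 := ℝ))) (Or.inr hC)
    simpa using this
  have h2 : Tendsto (fun i : ℕ => E.enorm (dilation ((i + 1 : ℕ) : ℝ) (rearr x)) /
      ENNReal.ofReal ((i + 1 : ℕ) : ℝ)) atTop (𝓝 0) :=
    hφ.comp (tendsto_natCast_atTop_atTop.comp (tendsto_add_atTop_nat 1))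
  have h3 : Tendsto (fun i : ℕ => ENNReal.ofReal (2 * (1 / 2) ^ i) * E.enorm x) atTop (𝓝 0) := by
    have h4 : Tendsto (fun i : ℕ => 2 * (1 / 2 : ℝ) ^ i) atTop (𝓝 0) := by
      simpa using (tendsto_pow_atTop_nhds_zero_of_lt_one (r := (1 / 2 : ℝ)) (by norm_num)
        (by norm_num)).const_mul 2
    have := ENNReal.Tendsto.mul_const ((ENNReal.continuous_ofReal.tendsto 0).comp h4)
      (Or.inr (enorm_lt_top_iff.2 hx).ne)
    simpa using this
  have h := (h1.add h2).add h3
  rw [add_zero, add_zero] at h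
  obtain ⟨i, hi⟩ := (h.eventually (gt_mem_nhds hδ)).exists
  obtain ⟨k, hk, hyk⟩ := hE.exists_enorm_sub_le hCb hx hy
    (show (0 : ℝ) < 1 / ((i : ℝ) + 1) by positivity) (Nat.succ_pos i) i
  exact ⟨k, hk, hyk.trans_lt hi⟩

/-- One inclusion is the approximation by equimeasurable functions, with the convex hull transported
from L₀ into E. For the other, the orbit is convex and L₁-closed, and convergence in E implies
convergence in L₁. -/
theorem IsFullySymmetric.orbit_eq (hE : E.IsFullySymmetric) {x : L0}
    (hx : x ∈ E.carrier) (hφ : Tendsto (fun s : ℝ => E.enorm (dilation s (rearr x)) /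
      ENNReal.ofReal s) atTop (𝓝 0)) :
    orbit x = E.closedConvexHull (extremePoints ℝ (orbit x)) := by
  have hx1 := hE.mem_L1 hx
  refine Subset.antisymm (fun y hy => ?_) ?_
  · have hyE := (hE.of_mem_orbit hx hy).1
    refine ⟨⟨y, hyE⟩, Metric.mem_closure_iff.2 fun δ hδ => ?_, rfl⟩
    obtain ⟨k, hk, hyk⟩ := hE.exists_enorm_sub_lt hx hφ hy (ENNReal.ofReal_pos.2 hδ)
    have hsub : equimeasurable x ⊆ E.carrier.subtype ''
        (((↑) : E.carrier → L0) ⁻¹' extremePoints ℝ (orbit x)) := fun z hz =>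
      ⟨⟨z, (hE.of_mem_orbit hx (mem_orbit_of_law_eq hx1 hz)).1⟩,
        equimeasurable_subset_extremePoints hx1 hz, rfl⟩
    have hk' := convexHull_mono hsub hk
    rw [← LinearMap.image_convexHull] at hk'
    obtain ⟨k', hk', rfl⟩ := hk'
    refine ⟨k', hk', ?_⟩
    have h : E.enorm (y - E.carrier.subtype k') =
        ENNReal.ofReal ‖(⟨y, hyE⟩ : E.carrier) - k'‖ := enorm_coe ((⟨y, hyE⟩ : E.carrier) - k')
    rw [h, ENNReal.ofReal_lt_ofReal_iff hδ] at hyk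
    rwa [dist_eq_norm]
  · rintro _ ⟨f, hf, rfl⟩
    have hconv : Convex ℝ (((↑) : E.carrier → L0) ⁻¹' orbit x) :=
      (orbit_convex x).linear_preimage E.carrier.subtype
    have hsub : convexHull ℝ (((↑) : E.carrier → L0) ⁻¹' extremePoints ℝ (orbit x)) ⊆
        ((↑) : E.carrier → L0) ⁻¹' orbit x :=
      convexHull_min (preimage_mono extremePoints_subset) hconv
    obtain ⟨C, hC, hCb⟩ := hE.exists_lintegral_le
    refine mem_orbit_of_approx (hE.mem_L1 f.2) fun ε hε => ?_
    have hlim : Tendsto (fun r : ℝ => C * ENNReal.ofReal r) (𝓝[>] 0) (𝓝 0) := by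
      have := ENNReal.Tendsto.const_mul (ENNReal.continuous_ofReal.tendsto 0) (Or.inr hC)
      rw [ENNReal.ofReal_zero, mul_zero] at this
      exact this.mono_left nhdsWithin_le_nhds
    obtain ⟨r, hr, hr0⟩ := ((hlim.eventually (gt_mem_nhds hε)).and self_mem_nhdsWithin).exists
    obtain ⟨g, hg, hfg⟩ := Metric.mem_closure_iff.1 hf r hr0
    refine ⟨g, hsub hg, lt_of_le_of_lt ?_ hr⟩
    have h1 : ∫⁻ t, ENNReal.ofReal |(f : L0) t - (g : L0) t| ∂leb =
        ∫⁻ t, ENNReal.ofReal |((f - g : E.carrier) : L0) t| ∂leb := by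
      refine lintegral_congr_ae ?_
      filter_upwards [AEEqFun.coeFn_sub (f : L0) (g : L0)] with t ht
      rw [Submodule.coe_sub, ht, Pi.sub_apply]
    rw [h1]
    refine (hCb _ (f - g).2).trans ?_
    rw [enorm_coe, ← dist_eq_norm]
    gcongr

/-! ### From dilation norms on E to the condition on a single function -/

theorem enorm_smul_le (f : L0) {c : ℝ} (hc : 0 < c) :
    E.enorm (c • f) ≤ ENNReal.ofReal c * E.enorm f := by
  by_cases hf : f ∈ E.carrier
  · rw [enorm_smul hf, abs_of_pos hc]
  · rw [show E.enorm f = ∞ from dif_neg hf, ENNReal.mul_top (ENNReal.ofReal_pos.2 hc).ne']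
    exact le_top

theorem IsFullySymmetric.enorm_rearr_le (hE : E.IsFullySymmetric) {x : L0} (hx : x ∈ E.carrier) :
    rearr x ∈ E.carrier ∧ E.enorm (rearr x) ≤ E.enorm x := by
  have h : ∀ φ : ℝ → ℝ≥0∞, Measurable φ →
      ∫⁻ t, φ |rearr x t| ∂leb = ∫⁻ t, φ |x t| ∂leb := fun φ hφ => by
    rw [← lintegral_law _ hφ, law_rearr, lintegral_law _ hφ]
  refine hE.of_lintegral_le hx ?_ fun l _ => (h _ (measurable_ofReal_sub l)).le
  rw [mem_L1_iff, h _ ENNReal.measurable_ofReal]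
  exact mem_L1_iff.1 (hE.mem_L1 hx)

theorem IsFullySymmetric.tendsto_dilation (hE : E.IsFullySymmetric)
    (h : Tendsto (fun τ : ℝ => E.dilationNorm τ / ENNReal.ofReal τ) atTop (𝓝 0)) {x : L0}
    (hx : x ∈ E.carrier) :
    Tendsto (fun s : ℝ => E.enorm (dilation s (rearr x)) / ENNReal.ofReal s) atTop (𝓝 0) := by
  obtain ⟨hr, hrx⟩ := hE.enorm_rearr_le hx
  -- Adding 1 keeps the normalizing constant positive when x = 0.
  set c := (E.enorm (rearr x)).toReal + 1 with hc
  have hc0 : 0 < c := by positivity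
  have hle : E.enorm (c⁻¹ • rearr x) ≤ 1 := by
    refine (enorm_smul_le _ (inv_pos.2 hc0)).trans ?_
    rw [← ENNReal.ofReal_toReal (enorm_lt_top_iff.2 hr).ne,
      ← ENNReal.ofReal_mul (inv_pos.2 hc0).le, ENNReal.ofReal_le_one, inv_mul_le_iff₀ hc0]
    linarith
  have hlim : Tendsto (fun s : ℝ => ENNReal.ofReal c * (E.dilationNorm s / ENNReal.ofReal s))
      atTop (𝓝 0) := by
    have := ENNReal.Tendsto.const_mul h (Or.inr (ENNReal.ofReal_ne_top (r := c)))
    rwa [mul_zero] at this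
  refine tendsto_of_tendsto_of_tendsto_of_le_of_le' tendsto_const_nhds hlim
    (Eventually.of_forall fun _ => bot_le) ?_
  filter_upwards [eventually_ge_atTop 1] with s hs
  rw [← mul_div_assoc]
  refine ENNReal.div_le_div_right ?_ _
  have e : dilation s (rearr x) = c • dilation s (c⁻¹ • rearr x) := by
    rw [dilation_smul _ _ hs, smul_smul, mul_inv_cancel₀ hc0.ne', one_smul]
  rw [e]
  refine (enorm_smul_le _ hc0).trans ?_
  gcongr
  exact le_iSup₂_of_le (c⁻¹ • rearr x) hle le_rfl

end FunctionSpace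

end SymmetricSpaces

end

theorem mainTheorem8 (E : SymmetricSpaces.FunctionSpace) (hE : E.IsFullySymmetric) :
    -- if `φ(x) = lim_{s → ∞} ‖σ_s(x*)‖ / s = 0`, then `Ω(x)` is the norm-closed convex hull of
    -- its extreme points
    (∀ x ∈ E.carrier,
      Filter.Tendsto
        (fun s : ℝ => E.enorm (SymmetricSpaces.dilation s (SymmetricSpaces.rearr x)) /
          ENNReal.ofReal s) Filter.atTop (nhds 0) →
      SymmetricSpaces.orbit x =
        E.closedConvexHull (Set.extremePoints ℝ (SymmetricSpaces.orbit x))) ∧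
    -- if `‖σ_τ‖ / τ → 0`, then this holds for every `x ∈ E`
    (Filter.Tendsto (fun τ : ℝ => E.dilationNorm τ / ENNReal.ofReal τ) Filter.atTop (nhds 0) →
      ∀ x ∈ E.carrier,
          SymmetricSpaces.orbit x =
          E.closedConvexHull (Set.extremePoints ℝ (SymmetricSpaces.orbit x))) :=
  ⟨fun _ hx hφ => hE.orbit_eq hx hφ, fun h _ hx => hE.orbit_eq hx (hE.tendsto_dilation h hx)⟩
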